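/- Let $S$ be a simply connected solvable real Lie group with Lie algebra $\mathfrak s$. Left-invariant Riemannian metrics on $S$ are identified with inner products on $\mathfrak s$, and $\operatorname{Aut}(S)$ with $\operatorname{Aut}(\mathfrak s)$. For a left-invariant metric $g$ let $\operatorname{Ric}_g:\mathfrak s\to\mathfrak s$ be its Ricci operator, $\operatorname{scal}_g=\operatorname{tr}\operatorname{Ric}_g$, and, when $\operatorname{Ric}_g\neq 0$, let $$F(g)=\frac{\operatorname{scal}_g^2}{|\operatorname{Ric}_g|^2}.$$ The metric $g$ is called a solvsoliton if $\operatorname{Ric}_g=cI+D$ for some $c\in\mathbb R$ and some derivation $D$ of $\mathfrak s$. **Theorem 1.2.** Suppose that the nilradical $\mathfrak n$ (the largest nilpotent ideal) of $\mathfrak s$ is abelian and that $S$ admits a solvsoliton $g$ with $\operatorname{Ric}_g\neq0$. Let $\mathfrak s=\mathfrak a\oplus\mathfrak n$ be the $g$-orthogonal decomposition, and let $\mathcal M$ be the set of all left-invariant metrics on $S$ for which $\mathfrak a\perp\mathfrak n$. Then every $g'\in\mathcal M$ has $\operatorname{Ric}_{g'}\neq 0$, so that $F$ is defined on $\mathcal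 M$, and 1. $F(g')\le F(g)$ for every $g'\in\mathcal M$; 2. if $g'\in\mathcal M$ is any other global maximum of $F$ on $\mathcal M$, then $g'$ is also a solvsoliton, and $g'=c\,\varphi^*g$ for some $c>0$ and some $\varphi\in\operatorname{Aut}(S)$. -/

import Mathlib

/-- The nilradical of a Lie algebra: the sum of all ideals that are nilpotent as Lie algebras.
In finite dimension it is the largest nilpotent ideal. -/
def lieNilradical (s : Type*) [LieRing s] [LieAlgebra ℝ s] : LieIdeal ℝ s :=
  sSup {I : LieIdeal ℝ s | LieRing.IsNilpotent I}

/-- A left-invariant Riemannian metric on the simply connected Lie group with Lie algebra `s`,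
given by its value at the identity: an inner product on `s`. -/
structure LeftInvMetric (s : Type*) [LieRing s] [LieAlgebra ℝ s] where
  /-- the inner product on the Lie algebra -/
  form : LinearMap.BilinForm ℝ s
  symm : ∀ x y, form x y = form y x
  pos : ∀ x, x ≠ 0 → 0 < form x x

namespace LeftInvMetric

variable {s : Type*} [LieRing s] [LieAlgebra ℝ s]

theorem nondegenerate (g : LeftInvMetric s) : g.form.Nondegenerate := by
  constructor
  · intro x hx
    by_contra h
    exact (g.pos x h).ne' (hx x)
  · intro x hx
    by_contra h
    exact (g.pos x h).ne' (hx x)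

theorem ext_left (g : LeftInvMetric s) {x y : s} (h : ∀ z, g.form x z = g.form y z) : x = y := by
  by_contra hne
  have h1 := g.pos (x - y) (sub_ne_zero.mpr hne)
  have h2 : g.form (x - y) (x - y) = g.form x (x - y) - g.form y (x - y) := by
    rw [← LinearMap.sub_apply, ← map_sub]
  rw [h2, h (x - y), sub_self] at h1
  exact lt_irrefl _ h1

/-- Two subspaces are orthogonal with respect to the metric. -/
def Perp (g : LeftInvMetric s) (U V : Submodule ℝ s) : Prop :=
  ∀ x ∈ U, ∀ y ∈ V, g.form x y = 0

/-- The right-hand side of the Koszul formula for left-invariant fields `x, y`,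
`z ↦ (⟨[x,y],z⟩ - ⟨[y,z],x⟩ + ⟨[z,x],y⟩) / 2`. -/
noncomputable def koszul (g : LeftInvMetric s) (x y : s) : Module.Dual ℝ s where
  toFun z := (g.form ⁅x, y⁆ z - g.form ⁅y, z⁆ x + g.form ⁅z, x⁆ y) / 2
  map_add' z w := by simp only [lie_add, add_lie, map_add, LinearMap.add_apply]; ring
  map_smul' c z := by
    simp only [lie_smul, smul_lie, map_smul, LinearMap.smul_apply, smul_eq_mul, RingHom.id_apply]
    ring

variable [FiniteDimensional ℝ s]

/-- The Levi-Civita connection on left-invariant vector fields, `nabla x y = ∇_x y`. -/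
noncomputable def nabla (g : LeftInvMetric s) : s →ₗ[ℝ] s →ₗ[ℝ] s :=
  LinearMap.mk₂ ℝ (fun x y => (g.form.toDual g.nondegenerate).symm (g.koszul x y))
    (fun x x' y => by
      rw [← map_add]; congr 1; ext z
      simp only [koszul, LinearMap.coe_mk, AddHom.coe_mk, LinearMap.add_apply, lie_add, add_lie,
        map_add]; ring)
    (fun c x y => by
      rw [← map_smul]; congr 1; ext z
      simp only [koszul, LinearMap.coe_mk, AddHom.coe_mk, LinearMap.smul_apply, lie_smul, smul_lie,
        map_smul, smul_eq_mul]; ring)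
    (fun x y y' => by
      rw [← map_add]; congr 1; ext z
      simp only [koszul, LinearMap.coe_mk, AddHom.coe_mk, LinearMap.add_apply, lie_add, add_lie,
        map_add]; ring)
    (fun c x y => by
      rw [← map_smul]; congr 1; ext z
      simp only [koszul, LinearMap.coe_mk, AddHom.coe_mk, LinearMap.smul_apply, lie_smul, smul_lie,
        map_smul, smul_eq_mul]; ring)

theorem form_nabla (g : LeftInvMetric s) (x y z : s) :
    g.form (g.nabla x y) z = (g.form ⁅x, y⁆ z - g.form ⁅y, z⁆ x + g.form ⁅z, x⁆ y) / 2 :=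
  LinearMap.BilinForm.apply_toDual_symm_apply (hB := g.nondegenerate) (g.koszul x y) z

theorem nabla_torsion_free (g : LeftInvMetric s) (x y : s) :
    g.nabla x y - g.nabla y x = ⁅x, y⁆ := by
  refine g.ext_left fun z => ?_
  rw [map_sub, LinearMap.sub_apply, form_nabla, form_nabla, ← lie_skew x y, ← lie_skew z x,
    ← lie_skew y z]
  simp only [map_neg, LinearMap.neg_apply]
  ring

theorem nabla_metric (g : LeftInvMetric s) (x y z : s) :
    g.form (g.nabla x y) z + g.form y (g.nabla x z) = 0 := by
  rw [g.symm y, form_nabla, form_nabla, ← lie_skew z y, ← lie_skew z x, ← lie_skew y x]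
  simp only [map_neg, LinearMap.neg_apply]
  ring

/-- The curvature tensor `R(x,y)z = ∇_x ∇_y z - ∇_y ∇_x z - ∇_[x,y] z`. -/
noncomputable def curvature (g : LeftInvMetric s) (x y z : s) : s :=
  g.nabla x (g.nabla y z) - g.nabla y (g.nabla x z) - g.nabla ⁅x, y⁆ z

/-- The endomorphism `z ↦ R(z,x)y`. -/
noncomputable def curvatureEnd (g : LeftInvMetric s) (x y : s) : s →ₗ[ℝ] s where
  toFun z := g.curvature z x y
  map_add' z w := by
    simp only [curvature, add_lie, map_add, LinearMap.add_apply]; abel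
  map_smul' c z := by
    simp only [curvature, smul_lie, map_smul, LinearMap.smul_apply, RingHom.id_apply, smul_sub]

/-- The Ricci tensor `ric(x,y) = tr (z ↦ R(z,x)y)`. -/
noncomputable def ricci (g : LeftInvMetric s) : LinearMap.BilinForm ℝ s :=
  LinearMap.mk₂ ℝ (fun x y => LinearMap.trace ℝ s (g.curvatureEnd x y))
    (fun x x' y => by
      rw [← map_add]; congr 1; ext z
      simp only [curvatureEnd, curvature, LinearMap.coe_mk, AddHom.coe_mk, LinearMap.add_apply,
        lie_add, map_add]; abel)
    (fun c x y => by
      rw [← map_smul]; congr 1; ext z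
      simp only [curvatureEnd, curvature, LinearMap.coe_mk, AddHom.coe_mk, LinearMap.smul_apply,
        lie_smul, map_smul, smul_sub])
    (fun x y y' => by
      rw [← map_add]; congr 1; ext z
      simp only [curvatureEnd, curvature, LinearMap.coe_mk, AddHom.coe_mk, LinearMap.add_apply,
        map_add]; abel)
    (fun c x y => by
      rw [← map_smul]; congr 1; ext z
      simp only [curvatureEnd, curvature, LinearMap.coe_mk, AddHom.coe_mk, LinearMap.smul_apply,
        map_smul, smul_sub])

/-- The Ricci operator, `⟨Ric x, y⟩ = ric(x,y)`. -/
noncomputable def ricciOp (g : LeftInvMetric s) : s →ₗ[ℝ] s :=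
  (g.form.toDual g.nondegenerate).symm.toLinearMap ∘ₗ g.ricci

theorem form_ricciOp (g : LeftInvMetric s) (x y : s) :
    g.form (g.ricciOp x) y = g.ricci x y :=
  LinearMap.BilinForm.apply_toDual_symm_apply (hB := g.nondegenerate) (g.ricci x) y

/-- The scalar curvature. -/
noncomputable def scal (g : LeftInvMetric s) : ℝ := LinearMap.trace ℝ s g.ricciOp

/-- The squared norm `|T|² = tr (Tᵗ T)` of an operator, with `Tᵗ` the adjoint of `T` for `g`. -/
noncomputable def normSq (g : LeftInvMetric s) (T : s →ₗ[ℝ] s) : ℝ :=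
  LinearMap.trace ℝ s (g.form.leftAdjointOfNondegenerate g.nondegenerate T ∘ₗ T)

/-- The Ricci pinching functional `F = scal² / |Ric|²`, meaningful where `Ric ≠ 0`. -/
noncomputable def F (g : LeftInvMetric s) : ℝ := g.scal ^ 2 / g.normSq g.ricciOp

/-- The metric is a solvsoliton (on a solvable `s`): `Ric = c I + D` with `D` a derivation. -/
def IsSolvsoliton (g : LeftInvMetric s) : Prop :=
  ∃ (c : ℝ) (D : LieDerivation ℝ s s), g.ricciOp = c • LinearMap.id + D.toLinearMap

end LeftInvMetric

/-!
Let `n` be the abelian nilradical and `a` its complement. Bracketing with `x ∈ a` gives an operator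
`θ(x)` on `n`; for a metric with `a ⊥ n` write `S(θ)` for the symmetric part of `θ`, `H ∈ a` for the
mean curvature vector and `N = ∑ [θ(eᵢ), θ(eᵢ)ᵗ]` for an orthonormal basis `eᵢ` of `a`.

*The soliton.* Let `Ric = cI + D`. Lie's theorem gives `[s, s] ⊆ n`, and an element with nilpotent
adjoint action lies in `n`. Hence the derivation `D` preserves `n`, and its symmetric restriction to
`a` vanishes, because an eigenvector with eigenvalue `d ≠ 0` would act nilpotently. Also `c < 0`, as
otherwise the nonpositive block `Ric|ₐ` would force `Ric = 0`. The `n`-block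
`K = N / 2 + μμᵗ / 4 = cI + D + S(θ(H))` of the Ricci operator, with `μ` the bracket `a × a → n`,
satisfies `tr K² = c |μ|² / 4 - ∑ |[H, eᵢ]|² / 2 ≤ 0`, so that `μ = 0` and `N = 0`; for commuting
`θ(eᵢ)` the latter makes all `θ(x)` normal (`IsAdapted.rigidity`).

*The estimate.* Since `μ = 0` does not depend on the metric, the Ricci operator of any competitor
`g'` is the sum of its `a`-block and `N' / 2 - S'(θ(H'))`, and these two terms on `n` are
orthogonal.
A normal operator minimizes the Hilbert–Schmidt norm among its conjugates by positive diagonal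
matrices (`Matrix.sum_sq_le_sum_conj_sq`, from `1 + 2 log x ≤ x²`); hence
`-ric'(x, x) ≥ -ric(x, x) = -c ⟨x, x⟩` for `x ∈ a`. Together with the Cauchy–Schwarz inequality on
the `a`-block and for `⟨H, H'⟩ = |H'|'²` this bounds `F(g')` by `F(g) = dim a + |H|² / (-c)`, and
the defect controls `|N'|²` and the trace-free part of the `a`-block
(`IsAdapted.normSq_ricciOp_pinching`).

*Equality.* Now `N' = 0`, so that every `θ(x)` is normal for both metrics. In a basis diagonalizing
both of them the equality case of the norm estimate shows that the diagonal change of basis commutes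
with `θ`. Rescaled, it is the required automorphism, and the two Ricci operators are
proportional.
-/

/-! ### The nilradical of a solvable Lie algebra -/

universe u

namespace LieModule

open LieAlgebra in
/-- A consequence of Lie's theorem: the derived algebra of a solvable Lie algebra acts by nilpotent
operators. The induction on the dimension splits off a common eigenvector. -/
theorem isNilpotent_toEnd_of_mem_derivedSeries {K L : Type*} [Field K] [CharZero K]
    [IsAlgClosed K] [LieRing L] [LieAlgebra K L] [IsSolvable L] (n : ℕ) :
    ∀ (V : Type u) [AddCommGroup V] [Module K V] [LieRingModule L V] [LieModule K L V]
    [FiniteDimensional K V], Module.finrank K V = n → ∀ x ∈ derivedSeries K L 1,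
    _root_.IsNilpotent (toEnd K L V x) := by
  induction n using Nat.strong_induction_on with
  | _ n ih =>
  intro V _ _ _ _ _ hV x hx
  rcases subsingleton_or_nontrivial V with h | h
  · exact ⟨0, LinearMap.ext fun v => Subsingleton.elim _ _⟩
  obtain ⟨χ, hχ⟩ := exists_nontrivial_weightSpace_of_isSolvable K L V
  obtain ⟨⟨v, hv⟩, hv0⟩ := exists_ne (0 : weightSpace V χ)
  have hv0 : v ≠ 0 := fun h => hv0 (Subtype.ext h)
  rw [mem_weightSpace] at hv
  let N : LieSubmodule K L V :=
    { Submodule.span K {v} with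
      lie_mem := by
        intro y m hm
        obtain ⟨c, rfl⟩ := Submodule.mem_span_singleton.mp hm
        refine Submodule.mem_span_singleton.mpr ⟨c * χ y, ?_⟩
        rw [lie_smul, hv, smul_smul] }
  have hχ0 : ∀ y z : L, χ ⁅y, z⁆ = 0 := by
    intro y z
    have h1 : χ ⁅y, z⁆ • v = 0 := by
      rw [← hv, lie_lie, hv z, hv y, lie_smul, lie_smul, hv z, hv y, smul_smul, smul_smul,
        mul_comm, sub_self]
    exact (smul_eq_zero.mp h1).resolve_right hv0
  have hxv : ⁅x, v⁆ = 0 := by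
    let J : LieIdeal K L := { χ.ker with lie_mem := fun {y m} _ => hχ0 y m }
    have hJ : derivedSeries K L 1 ≤ J :=
      (LieSubmodule.lie_le_iff _ J _).mpr fun y _ z _ => hχ0 y z
    have hx' : χ x = 0 := hJ hx
    rw [hv, hx', zero_smul]
  have hlt : Module.finrank K (V ⧸ N) < n := by
    have h1 := Submodule.finrank_quotient_add_finrank N.toSubmodule
    have h2 : Module.finrank K N.toSubmodule = 1 := finrank_span_singleton hv0
    have h3 : Module.finrank K (V ⧸ N) = Module.finrank K (V ⧸ N.toSubmodule) := rfl
    omega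
  obtain ⟨k, hk⟩ := ih _ hlt (V ⧸ N) rfl x hx
  refine ⟨k + 1, LinearMap.ext fun w => ?_⟩
  have hq : ∀ (j : ℕ) (w : V), ((toEnd K L (V ⧸ N) x) ^ j) (LieSubmodule.Quotient.mk w) =
      LieSubmodule.Quotient.mk (((toEnd K L V x) ^ j) w) := by
    intro j
    induction j with
    | zero => intro w; rfl
    | succ j ihj =>
      intro w
      rw [pow_succ, pow_succ, Module.End.mul_apply, Module.End.mul_apply, ← ihj]
      rfl
  have := hq k w
  rw [hk, LinearMap.zero_apply] at this
  have hm : ((toEnd K L V x) ^ k) w ∈ N := (LieSubmodule.Quotient.mk_eq_zero').mp this.symm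
  obtain ⟨c, hc⟩ := Submodule.mem_span_singleton.mp hm
  rw [pow_succ', Module.End.mul_apply, ← hc, map_smul, toEnd_apply_apply, hxv, smul_zero,
    LinearMap.zero_apply]

end LieModule

namespace LieAlgebra

theorem lie_eq_zero_of_mem_lieNilradical {s : Type*} [LieRing s] [LieAlgebra ℝ s]
    (hn : IsLieAbelian (lieNilradical s))
    {x y : s} (hx : x ∈ lieNilradical s) (hy : y ∈ lieNilradical s) : ⁅x, y⁆ = 0 :=
  congrArg Subtype.val (hn.trivial ⟨x, hx⟩ ⟨y, hy⟩)

variable {s : Type u} [LieRing s] [LieAlgebra ℝ s] [FiniteDimensional ℝ s] [IsSolvable s]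

theorem lie_mem_lieNilradical (x y : s) : ⁅x, y⁆ ∈ lieNilradical s := by
  have hle : derivedSeries ℝ s 1 ≤ lieNilradical s := by
    refine le_sSup ?_
    change LieRing.IsNilpotent _
    rw [isNilpotent_iff_forall (R := ℝ)]
    rintro ⟨z, hz⟩
    apply LieSubalgebra.isNilpotent_ad_of_isNilpotent_ad
      (derivedSeries ℝ s 1 : LieSubalgebra ℝ s) (x := ⟨z, hz⟩)
    have hz' : (1 : ℂ) ⊗ₜ[ℝ] z ∈ derivedSeries ℂ (TensorProduct ℝ ℂ s) 1 := by
      rw [derivedSeries_baseChange]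
      exact Submodule.tmul_mem_baseChange_of_mem 1 hz
    have h := LieModule.isNilpotent_toEnd_of_mem_derivedSeries _ (TensorProduct ℝ ℂ s) rfl _ hz'
    rw [LieModule.toEnd_baseChange] at h
    exact (IsNilpotent.map_iff
      (f := Module.End.baseChangeHom ℝ ℂ s) (LinearMap.baseChangeHom_injective ℝ s ℂ)).mp h
  exact hle (LieSubmodule.lie_mem_lie (LieSubmodule.mem_top x) (LieSubmodule.mem_top y))

/-- The ideal spanned by the nilradical and `u` is nilpotent by Engel's theorem. -/
theorem mem_lieNilradical_of_isNilpotent_ad (hn : IsLieAbelian (lieNilradical s)) {u : s}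
    (hu : IsNilpotent (ad ℝ s u)) : u ∈ lieNilradical s := by
  let J : LieIdeal ℝ s :=
    { (lieNilradical s).toSubmodule ⊔ Submodule.span ℝ {u} with
      lie_mem := fun {y m} _ => Submodule.mem_sup_left (lie_mem_lieNilradical y m) }
  have hJ : J ≤ lieNilradical s := by
    refine le_sSup ?_
    change LieRing.IsNilpotent _
    rw [isNilpotent_iff_forall (R := ℝ)]
    rintro ⟨z, hz⟩
    apply LieSubalgebra.isNilpotent_ad_of_isNilpotent_ad (J : LieSubalgebra ℝ s) (x := ⟨z, hz⟩)
    obtain ⟨v, hv, w, hw, rfl⟩ := Submodule.mem_sup.mp hz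
    obtain ⟨t, rfl⟩ := Submodule.mem_span_singleton.mp hw
    obtain ⟨k, hk⟩ := hu
    have key : ∀ j : ℕ, ∀ m ∈ lieNilradical s,
        ((ad ℝ s (v + t • u)) ^ j) m = t ^ j • ((ad ℝ s u) ^ j) m := by
      intro j
      induction j with
      | zero => intro m _; simp
      | succ j ih =>
        intro m hm
        rw [pow_succ, Module.End.mul_apply, pow_succ (ad ℝ s u), Module.End.mul_apply, ad_apply,
          add_lie, lie_eq_zero_of_mem_lieNilradical hn hv hm, zero_add, smul_lie, map_smul,
          ih _ (lie_mem_lieNilradical u m), ad_apply, smul_smul, pow_succ']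
    refine ⟨k + 1, LinearMap.ext fun m => ?_⟩
    rw [pow_succ, Module.End.mul_apply]
    change ((ad ℝ s (v + t • u)) ^ k) ⁅v + t • u, m⁆ = 0
    rw [key _ _ (lie_mem_lieNilradical _ m), hk, LinearMap.zero_apply, smul_zero]
  exact hJ (Submodule.mem_sup_right (Submodule.mem_span_singleton_self u))

/-- Derivations preserve the nilradical `n` when it is abelian: for `x ∈ n`, applying `D` twice to
`⁅x, ⁅x, ·⁆⁆ = 0` shows that `ad (D x)` squares to zero on `n`. -/
theorem derivation_mem_lieNilradical (hn : IsLieAbelian (lieNilradical s)) (D : LieDerivation ℝ s s)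
    {x : s} (hx : x ∈ lieNilradical s) : D x ∈ lieNilradical s := by
  apply mem_lieNilradical_of_isNilpotent_ad hn
  have h0 : ∀ {y z : s}, y ∈ lieNilradical s → z ∈ lieNilradical s → ⁅y, z⁆ = 0 :=
    lie_eq_zero_of_mem_lieNilradical hn
  have key : ∀ y ∈ lieNilradical s, ⁅D x, ⁅D x, y⁆⁆ = 0 := by
    intro y hy
    have h1 : ∀ z : s, ⁅x, ⁅x, z⁆⁆ = 0 := fun z => h0 hx (lie_mem_lieNilradical x z)
    have h2 : ∀ z : s, ⁅D x, ⁅x, z⁆⁆ + ⁅x, ⁅D x, z⁆⁆ = 0 := by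
      intro z
      have := congrArg D (h1 z)
      rw [LieDerivation.apply_lie_eq_add, LieDerivation.apply_lie_eq_add, lie_add, h1, zero_add,
        map_zero] at this
      rwa [add_comm]
    have h3 : ⁅x, ⁅D (D x), y⁆⁆ = 0 := h0 hx (lie_mem_lieNilradical _ y)
    have h4 := congrArg D (h2 y)
    simp only [LieDerivation.apply_lie_eq_add, lie_add, map_add, map_zero] at h4
    have h5 := h2 (D y)
    rw [h0 hx hy, lie_zero, h3] at h4
    have h6 : (2 : ℝ) • ⁅D x, ⁅D x, y⁆⁆ = 0 := by
      rw [two_smul]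
      refine Eq.trans ?_ ((congrArg₂ (· - ·) h4 h5).trans (sub_zero 0))
      abel
    exact (smul_eq_zero.mp h6).resolve_left two_ne_zero
  refine ⟨3, LinearMap.ext fun z => ?_⟩
  exact key _ (lie_mem_lieNilradical (D x) z)

/-- If `[A, B] = d B` with `d ≠ 0` then `B ^ k` lies in the eigenspace of `[A, ·]` for `k * d`, and
there are only finitely many eigenvalues. -/
theorem isNilpotent_of_lie_eq_smul {V : Type*} [AddCommGroup V] [Module ℝ V]
    [FiniteDimensional ℝ V] (A B : Module.End ℝ V) {d : ℝ} (hd : d ≠ 0)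
    (h : A * B - B * A = d • B) :
    IsNilpotent B := by
  by_contra hB
  have hne : ∀ k, B ^ k ≠ 0 := fun k hk => hB ⟨k, hk⟩
  let T : Module.End ℝ (Module.End ℝ V) := LinearMap.mulLeft ℝ A - LinearMap.mulRight ℝ A
  have hT : ∀ X, T X = A * X - X * A := fun X => rfl
  have hk : ∀ k : ℕ, T (B ^ k) = (k * d) • B ^ k := by
    intro k
    induction k with
    | zero => simp [hT]
    | succ k ih =>
      have : T (B ^ (k + 1)) = T (B ^ k) * B + B ^ k * (A * B - B * A) := by
        rw [hT, hT, pow_succ]; noncomm_ring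
      rw [this, ih, h, Nat.cast_succ, add_mul, one_mul, add_smul, mul_smul_comm, smul_mul_assoc,
        ← pow_succ]
  have hfin := Module.End.finite_hasEigenvalue T
  refine Set.infinite_of_injective_forall_mem (f := fun k : ℕ => (k * d : ℝ)) ?_ ?_ hfin
  · intro i j hij
    exact_mod_cast mul_right_cancel₀ hd hij
  · intro k
    exact Module.End.hasEigenvalue_of_hasEigenvector (x := B ^ k)
      (Module.End.hasEigenvector_iff.mpr ⟨Module.End.mem_eigenspace_iff.mpr (hk k), hne k⟩)

theorem mem_lieNilradical_of_derivation_apply_eq_smul (hn : IsLieAbelian (lieNilradical s))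
    (D : LieDerivation ℝ s s) {u : s} {d : ℝ} (hd : d ≠ 0) (hu : D u = d • u) :
    u ∈ lieNilradical s := by
  refine mem_lieNilradical_of_isNilpotent_ad hn (isNilpotent_of_lie_eq_smul D.toLinearMap _ hd ?_)
  ext z
  change D ⁅u, z⁆ - ⁅u, D z⁆ = d • ⁅u, z⁆
  rw [LieDerivation.apply_lie_eq_add, hu, smul_lie]
  abel

end LieAlgebra

/-! ### Normal matrices and conjugation by positive diagonal matrices -/

theorem eq_zero_of_sum_sum_sq_nonpos {α β : Type*} [Fintype α] [Fintype β] {f : α → β → ℝ}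
    (h : ∑ i, ∑ j, f i j ^ 2 ≤ 0) (i : α) (j : β) : f i j = 0 := by
  have h1 := (Finset.sum_eq_zero_iff_of_nonneg fun i _ => by positivity).mp
    (le_antisymm h (by positivity)) i (Finset.mem_univ i)
  have h2 := (Finset.sum_eq_zero_iff_of_nonneg fun j _ => by positivity).mp h1 j (Finset.mem_univ j)
  exact (pow_eq_zero_iff two_ne_zero).mp h2

namespace Matrix

variable {ι κ : Type*} [Fintype ι] [Fintype κ]

theorem trace_commutator_transpose_mul {A E : Matrix κ κ ℝ} (h : A * E = E * A) :
    ((A * Aᵀ - Aᵀ * A) * E).trace = 0 := by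
  rw [sub_mul, trace_sub, Matrix.mul_assoc Aᵀ, h, ← Matrix.mul_assoc,
    Matrix.trace_mul_comm (Aᵀ * E), ← Matrix.mul_assoc, sub_self]

theorem trace_mul_transpose_self (A : Matrix κ κ ℝ) : (A * Aᵀ).trace = ∑ k, ∑ l, A k l ^ 2 := by
  simp [trace, mul_apply, sq]

theorem trace_mul_transpose_add_trace_mul_self (A : Matrix κ κ ℝ) :
    (A * Aᵀ).trace + (A * A).trace = (1 / 2) * ∑ k, ∑ l, (A k l + A l k) ^ 2 := by
  have h1 := Finset.sum_comm (s := Finset.univ) (t := Finset.univ) (f := fun k l => A l k ^ 2)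
  have h2 : ∑ k, ∑ l, (A k l + A l k) ^ 2 =
      ∑ k, ∑ l, A k l ^ 2 + ∑ k, ∑ l, A l k ^ 2 + 2 * ∑ k, ∑ l, A k l * A l k := by
    simp only [Finset.mul_sum, ← Finset.sum_add_distrib]
    refine Finset.sum_congr rfl fun k _ => Finset.sum_congr rfl fun l _ => ?_
    ring
  rw [h2, h1]
  simp only [Matrix.trace, diag_apply, mul_apply, transpose_apply, sq]
  ring

/-- The Hilbert–Schmidt norm of `[X, Yᵀ]` for commuting `X`, `Y`: by the Jacobi identity it is the
pairing of the commutators `[X, Xᵀ]` and `[Y, Yᵀ]`. -/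
theorem trace_commutator_sq {X Y : Matrix κ κ ℝ} (h : X * Y = Y * X) :
    ((X * Yᵀ - Yᵀ * X) * (X * Yᵀ - Yᵀ * X)ᵀ).trace =
      ((X * Xᵀ - Xᵀ * X) * (Y * Yᵀ - Yᵀ * Y)).trace := by
  have hT : Xᵀ * Yᵀ = Yᵀ * Xᵀ := by rw [← transpose_mul, ← transpose_mul, h]
  have e1 : (X * Yᵀ * (Y * Xᵀ)).trace = (Xᵀ * X * (Yᵀ * Y)).trace := by
    rw [Matrix.trace_mul_comm (Xᵀ * X), ← Matrix.mul_assoc, Matrix.trace_mul_comm _ Xᵀ]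
    rw [Matrix.trace_mul_comm (Yᵀ * Y)]
    simp only [Matrix.mul_assoc]
  have e2 : (X * Yᵀ * (Xᵀ * Y)).trace = (X * Xᵀ * (Yᵀ * Y)).trace := by
    rw [Matrix.mul_assoc, ← Matrix.mul_assoc Yᵀ, ← hT]
    simp only [Matrix.mul_assoc]
  have e3 : (Yᵀ * X * (Y * Xᵀ)).trace = (X * Xᵀ * (Yᵀ * Y)).trace := by
    rw [Matrix.trace_mul_comm (X * Xᵀ), Matrix.mul_assoc, ← Matrix.mul_assoc X, h]
    simp only [Matrix.mul_assoc]
  have e4 : (Yᵀ * X * (Xᵀ * Y)).trace = (X * Xᵀ * (Y * Yᵀ)).trace := by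
    rw [Matrix.mul_assoc, Matrix.trace_mul_comm]
    simp only [Matrix.mul_assoc]
  have e5 : (Xᵀ * X * (Y * Yᵀ)).trace = (X * Xᵀ * (Yᵀ * Y)).trace := by
    have c1 : Xᵀ * X * (Y * Yᵀ) = Xᵀ * (Y * X * Yᵀ) := by rw [← h]; simp only [Matrix.mul_assoc]
    have c2 : Y * X * Yᵀ * Xᵀ = Y * X * Xᵀ * Yᵀ := by
      rw [Matrix.mul_assoc, ← hT, Matrix.mul_assoc (Y * X)]
    rw [c1, Matrix.trace_mul_comm, c2, Matrix.trace_mul_comm, ← Matrix.mul_assoc,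
      ← Matrix.mul_assoc, Matrix.mul_assoc, Matrix.trace_mul_comm]
  simp only [transpose_sub, transpose_mul, transpose_transpose, sub_mul, mul_sub, trace_sub, e1,
    e2, e3, e4, e5]
  ring

/-- A commuting family with `∑ [Aᵢ, Aᵢᵀ] = 0`, a critical point of `∑ ‖Aᵢ‖²` on its conjugation
orbit, consists of normal matrices, and moreover each `Aᵢ` commutes with every `Aⱼᵀ`. -/
theorem mul_transpose_comm_of_sum_commutator_eq_zero {A : ι → Matrix κ κ ℝ}
    (hA : ∀ i j, A i * A j = A j * A i) (h : ∑ i, (A i * (A i)ᵀ - (A i)ᵀ * A i) = 0) (i j : ι) :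
    A i * (A j)ᵀ = (A j)ᵀ * A i := by
  have h1 : ∑ i, ((A i * (A j)ᵀ - (A j)ᵀ * A i) * (A i * (A j)ᵀ - (A j)ᵀ * A i)ᵀ).trace = 0 := by
    simp_rw [fun i => trace_commutator_sq (hA i j)]
    rw [← trace_sum, ← Finset.sum_mul, h, zero_mul, trace_zero]
  have h2 := (Finset.sum_eq_zero_iff_of_nonneg fun i _ => by
    rw [trace_mul_transpose_self]; positivity).mp h1 i (Finset.mem_univ i)
  have h3 := (trace_mul_conjTranspose_self_eq_zero_iff (A := A i * (A j)ᵀ - (A j)ᵀ * A i)).mp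
  rw [conjTranspose_eq_transpose_of_trivial] at h3
  exact sub_eq_zero.mp (h3 h2)

/-- The inequality `1 + 2 log x ≤ x ^ 2` at `x = w k / w l`, multiplied by `a ^ 2`. -/
theorem conj_sq_sub_nonneg {κ : Type*} (w : κ → ℝ) (hw : ∀ k, 0 < w k) (a : ℝ) (k l : κ) :
    0 ≤ (w k * a * (w l)⁻¹) ^ 2 - a ^ 2 - a ^ 2 * (2 * Real.log (w k) - 2 * Real.log (w l)) := by
  have hx : 0 < w k / w l := div_pos (hw k) (hw l)
  have h1 := Real.add_one_le_exp (2 * Real.log (w k / w l))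
  have h2 : Real.exp (2 * Real.log (w k / w l)) = (w k / w l) ^ 2 := by
    rw [two_mul, Real.exp_add, Real.exp_log hx, sq]
  rw [h2, Real.log_div (hw k).ne' (hw l).ne'] at h1
  have h3 : (w k * a * (w l)⁻¹) ^ 2 = a ^ 2 * (w k / w l) ^ 2 := by rw [div_eq_mul_inv]; ring
  rw [h3]
  nlinarith [sq_nonneg a]

variable {A : Matrix κ κ ℝ} {w : κ → ℝ}

/-- The row sums of `A k l ^ 2` agree with the column sums when `A` is normal. -/
theorem sum_sq_mul_sub_eq_zero (hA : A * Aᵀ = Aᵀ * A) (u : κ → ℝ) :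
    ∑ k, ∑ l, A k l ^ 2 * (u k - u l) = 0 := by
  have h : ∀ k, ∑ l, A k l ^ 2 = ∑ l, A l k ^ 2 := by
    intro k
    have := congrFun (congrFun hA k) k
    simpa [mul_apply, ← sq] using this
  simp only [mul_sub, Finset.sum_sub_distrib]
  rw [Finset.sum_comm (f := fun k l => A k l ^ 2 * u l)]
  simp_rw [← Finset.sum_mul, h, sub_self]

/-- A normal matrix minimizes the Hilbert–Schmidt norm among its conjugates by positive diagonal
matrices. -/
theorem sum_sq_le_sum_conj_sq (hA : A * Aᵀ = Aᵀ * A) (hw : ∀ k, 0 < w k) :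
    ∑ k, ∑ l, A k l ^ 2 ≤ ∑ k, ∑ l, (w k * A k l * (w l)⁻¹) ^ 2 := by
  have h := Finset.sum_nonneg fun k (_ : k ∈ Finset.univ) => Finset.sum_nonneg fun l
    (_ : l ∈ Finset.univ) => conj_sq_sub_nonneg w hw (A k l) k l
  simp only [Finset.sum_sub_distrib] at h
  have := sum_sq_mul_sub_eq_zero hA (fun k => 2 * Real.log (w k))
  linarith

/-- The equality case of `sum_sq_le_sum_conj_sq`: the diagonal matrix commutes with `A`. -/
theorem mul_eq_mul_of_sum_conj_sq_le (hA : A * Aᵀ = Aᵀ * A) (hw : ∀ k, 0 < w k)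
    (h : ∑ k, ∑ l, (w k * A k l * (w l)⁻¹) ^ 2 ≤ ∑ k, ∑ l, A k l ^ 2) (k l : κ) :
    w k * A k l = A k l * w l := by
  have h1 : ∑ k, ∑ l, ((w k * A k l * (w l)⁻¹) ^ 2 - A k l ^ 2 -
      A k l ^ 2 * (2 * Real.log (w k) - 2 * Real.log (w l))) = 0 := by
    refine le_antisymm ?_ (Finset.sum_nonneg fun k _ => Finset.sum_nonneg fun l _ =>
      conj_sq_sub_nonneg w hw (A k l) k l)
    have := sum_sq_mul_sub_eq_zero hA (fun k => 2 * Real.log (w k))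
    simp only [Finset.sum_sub_distrib]
    linarith
  have h2 := (Finset.sum_eq_zero_iff_of_nonneg fun k _ => Finset.sum_nonneg fun l _ =>
      conj_sq_sub_nonneg w hw (A k l) k l).mp h1 k (Finset.mem_univ k)
  have h3 := (Finset.sum_eq_zero_iff_of_nonneg fun l _ =>
      conj_sq_sub_nonneg w hw (A k l) k l).mp h2 l (Finset.mem_univ l)
  have h4 : (w k * A k l * (w l)⁻¹) ^ 2 = A k l ^ 2 * (w k / w l) ^ 2 := by
    rw [div_eq_mul_inv]; ring
  have hx : 0 < w k / w l := div_pos (hw k) (hw l)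
  rw [h4, ← mul_sub, ← Real.log_div (hw k).ne' (hw l).ne'] at h3
  have h5 : A k l ^ 2 * ((w k / w l) ^ 2 - 1 - 2 * Real.log (w k / w l)) = 0 := by
    linarith
  rcases mul_eq_zero.mp h5 with h6 | h6
  · rw [pow_eq_zero_iff two_ne_zero] at h6
    rw [h6]
    ring
  · have h7 : w k / w l = 1 := by
      have h8 : Real.exp (2 * Real.log (w k / w l)) = (w k / w l) ^ 2 := by
        rw [two_mul, Real.exp_add, Real.exp_log hx, sq]
      by_contra hne
      have := Real.add_one_lt_exp (x := 2 * Real.log (w k / w l))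
        (mul_ne_zero two_ne_zero (Real.log_ne_zero_of_pos_of_ne_one hx hne))
      rw [h8] at this
      linarith
    rw [div_eq_one_iff_eq (hw l).ne'] at h7
    rw [h7, mul_comm]

end Matrix

/-- Simultaneous diagonalization of an inner product and a symmetric bilinear form. -/
theorem exists_basis_simultaneous_diagonal {V : Type*} [AddCommGroup V] [Module ℝ V]
    [FiniteDimensional ℝ V] (B B' : LinearMap.BilinForm ℝ V) (hB : ∀ x y, B x y = B y x)
    (hpos : ∀ x, x ≠ 0 → 0 < B x x) (hB' : ∀ x y, B' x y = B' y x) :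
    ∃ (b : Module.Basis (Fin (Module.finrank ℝ V)) ℝ V) (p : Fin (Module.finrank ℝ V) → ℝ),
      (∀ i j, B (b i) (b j) = if i = j then 1 else 0) ∧
      ∀ i j, B' (b i) (b j) = if i = j then p i else 0 := by
  have hnd : B.Nondegenerate := by
    constructor
    · intro x hx; by_contra h; exact (hpos x h).ne' (hx x)
    · intro x hx; by_contra h; exact (hpos x h).ne' (hx x)
  let core : InnerProductSpace.Core ℝ V :=
    { inner := fun x y => B x y
      conj_inner_symm := fun x y => hB y x
      re_inner_nonneg := fun x => by
        by_cases h : x = 0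
        · simp [h]
        · exact (hpos x h).le
      add_left := fun x y z => by simp
      smul_left := fun x y r => by simp
      definite := fun x hx => by
        by_contra h; exact (hpos x h).ne' hx }
  let _ : NormedAddCommGroup V := core.toNormedAddCommGroup
  let _ : InnerProductSpace ℝ V := InnerProductSpace.ofCore core.toCore
  have hinner : ∀ x y : V, inner ℝ x y = B x y := fun x y => rfl
  let T : V →ₗ[ℝ] V := (B.toDual hnd).symm.toLinearMap ∘ₗ B'
  have hT : ∀ x y, B (T x) y = B' x y := fun x y =>
    LinearMap.BilinForm.apply_toDual_symm_apply (hB := hnd) (B' x) y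
  have hsymm : T.IsSymmetric := fun x y => by
    rw [hinner, hinner, hT, hB x, hT, hB']
  refine ⟨(hsymm.eigenvectorBasis rfl).toBasis, hsymm.eigenvalues rfl, ?_⟩
  have h1 : ∀ i j, B (hsymm.eigenvectorBasis rfl i) (hsymm.eigenvectorBasis rfl j) =
      if i = j then 1 else 0 := fun i j =>
    orthonormal_iff_ite.mp (hsymm.eigenvectorBasis rfl).orthonormal i j
  refine ⟨fun i j => by simpa using h1 i j, fun i j => ?_⟩
  rw [OrthonormalBasis.coe_toBasis, ← hT, hsymm.apply_eigenvectorBasis]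
  simp [h1]

/-! ### The Ricci tensor in an orthonormal basis -/

namespace LeftInvMetric

section

variable {s : Type*} [LieRing s] [LieAlgebra ℝ s]
variable {ι : Type*} [Fintype ι] [DecidableEq ι] {g : LeftInvMetric s} {b : Module.Basis ι ℝ s}

theorem repr_eq_form (hb : ∀ i j, g.form (b i) (b j) = if i = j then 1 else 0) (x : s) (i : ι) :
    b.repr x i = g.form x (b i) := by
  have h := congrArg (fun z => g.form z (b i)) (b.sum_repr x)
  simpa only [map_sum, map_smul, LinearMap.sum_apply, LinearMap.smul_apply, hb, smul_eq_mul,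
    mul_ite, mul_one, mul_zero, Finset.sum_ite_eq', Finset.mem_univ, if_true] using h

theorem sum_form_smul (hb : ∀ i j, g.form (b i) (b j) = if i = j then 1 else 0) (x : s) :
    ∑ i, g.form x (b i) • b i = x := by
  simp_rw [← repr_eq_form hb]
  exact b.sum_repr x

theorem form_eq_sum (hb : ∀ i j, g.form (b i) (b j) = if i = j then 1 else 0) (x y : s) :
    g.form x y = ∑ i, g.form x (b i) * g.form y (b i) := by
  conv_lhs => rw [← sum_form_smul hb y]
  simp [mul_comm]

theorem trace_eq_sum_form (hb : ∀ i j, g.form (b i) (b j) = if i = j then 1 else 0)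
    (T : s →ₗ[ℝ] s) : LinearMap.trace ℝ s T = ∑ i, g.form (T (b i)) (b i) := by
  rw [LinearMap.trace_eq_matrix_trace ℝ b, Matrix.trace]
  simp [LinearMap.toMatrix_apply, repr_eq_form hb]

end

variable {s : Type*} [LieRing s] [LieAlgebra ℝ s] [FiniteDimensional ℝ s]

/-- The mean curvature vector `H`, defined by `⟨H, x⟩ = tr (ad x)`. -/
noncomputable def meanCurvature (g : LeftInvMetric s) : s :=
  (g.form.toDual g.nondegenerate).symm
    { toFun := fun x => LinearMap.trace ℝ s (LieAlgebra.ad ℝ s x)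
      map_add' := fun x y => by rw [map_add, map_add]
      map_smul' := fun c x => by rw [map_smul, map_smul, RingHom.id_apply] }

theorem form_meanCurvature (g : LeftInvMetric s) (x : s) :
    g.form g.meanCurvature x = LinearMap.trace ℝ s (LieAlgebra.ad ℝ s x) :=
  LinearMap.BilinForm.apply_toDual_symm_apply (hB := g.nondegenerate) _ x

theorem trace_ad_lie {s : Type*} [LieRing s] [LieAlgebra ℝ s] (x y : s) :
    LinearMap.trace ℝ s (LieAlgebra.ad ℝ s ⁅x, y⁆) = 0 := by
  have h : LieAlgebra.ad ℝ s ⁅x, y⁆ =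
      LieAlgebra.ad ℝ s x * LieAlgebra.ad ℝ s y - LieAlgebra.ad ℝ s y * LieAlgebra.ad ℝ s x :=
    LinearMap.ext fun z => lie_lie x y z
  rw [h, map_sub, LinearMap.trace_mul_comm, sub_self]

section Orthonormal

variable {ι : Type*} [Fintype ι] [DecidableEq ι] {g : LeftInvMetric s} {b : Module.Basis ι ℝ s}

theorem normSq_eq_sum (hb : ∀ i j, g.form (b i) (b j) = if i = j then 1 else 0) (T : s →ₗ[ℝ] s) :
    g.normSq T = ∑ i, ∑ j, g.form (T (b i)) (b j) ^ 2 := by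
  rw [normSq, trace_eq_sum_form hb]
  refine Finset.sum_congr rfl fun i _ => ?_
  have h := LinearMap.BilinForm.isAdjointPairLeftAdjointOfNondegenerate g.form g.nondegenerate T
  rw [LinearMap.comp_apply, h, form_eq_sum hb]
  simp only [sq]

/-- The Ricci tensor in terms of the structure constants in an orthonormal basis: the four terms are
the two contributions of `ad x` and `ad y` (the second one is the Killing form), the contribution of
the brackets with components along `x` and `y`, and the symmetric part of `ad H`. -/
theorem ricci_eq_sum (hb : ∀ i j, g.form (b i) (b j) = if i = j then 1 else 0) (x y : s) :
    g.ricci x y =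
      -(1 / 2) * ∑ i, ∑ j, g.form ⁅x, b i⁆ (b j) * g.form ⁅y, b i⁆ (b j)
      - (1 / 2) * ∑ i, ∑ j, g.form ⁅x, b i⁆ (b j) * g.form ⁅y, b j⁆ (b i)
      + (1 / 4) * ∑ i, ∑ j, g.form ⁅b i, b j⁆ x * g.form ⁅b i, b j⁆ y
      - (1 / 2) * (g.form ⁅g.meanCurvature, x⁆ y + g.form ⁅g.meanCurvature, y⁆ x) := by
  have hH : ∀ z, ∑ i, g.form z (g.nabla (b i) (b i)) = g.form g.meanCurvature z := by
    intro z
    rw [form_meanCurvature, trace_eq_sum_form hb]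
    refine Finset.sum_congr rfl fun i _ => ?_
    rw [g.symm, form_nabla, lie_self, map_zero, LinearMap.zero_apply, ← lie_skew]
    simp only [LieAlgebra.ad_apply, map_neg, LinearMap.neg_apply]
    ring
  have h1 : g.ricci x y = ∑ i, (g.form (g.nabla (b i) (g.nabla x y)) (b i)
      - g.form (g.nabla x (g.nabla (b i) y)) (b i) - g.form (g.nabla ⁅b i, x⁆ y) (b i)) := by
    change LinearMap.trace ℝ s (g.curvatureEnd x y) = _
    rw [trace_eq_sum_form hb]
    refine Finset.sum_congr rfl fun i _ => ?_
    change g.form (g.curvature (b i) x y) (b i) = _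
    rw [curvature, map_sub, map_sub, LinearMap.sub_apply, LinearMap.sub_apply]
  have h2 : ∀ i, g.form (g.nabla (b i) (g.nabla x y)) (b i) =
      - g.form (g.nabla x y) (g.nabla (b i) (b i)) := fun i =>
    eq_neg_of_add_eq_zero_left (g.nabla_metric _ _ _)
  have h3 : ∀ i, g.form (g.nabla x (g.nabla (b i) y)) (b i) =
      - ∑ k, g.form (g.nabla (b i) y) (b k) * g.form (g.nabla x (b i)) (b k) := fun i => by
    rw [eq_neg_of_add_eq_zero_left (g.nabla_metric x (g.nabla (b i) y) (b i)), form_eq_sum hb]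
  have h4 : ∀ i, g.form (g.nabla ⁅b i, x⁆ y) (b i) =
      ∑ k, g.form ⁅b i, x⁆ (b k) * g.form (g.nabla (b k) y) (b i) := fun i => by
    conv_lhs => rw [← sum_form_smul hb ⁅b i, x⁆]
    simp
  have h5 : g.ricci x y = - g.form g.meanCurvature (g.nabla x y) +
      ∑ i, ∑ k, g.form (g.nabla (b i) y) (b k) *
        (g.form (g.nabla x (b i)) (b k) - g.form ⁅b k, x⁆ (b i)) := by
    rw [h1]
    simp only [h2, h3, h4, Finset.sum_sub_distrib, Finset.sum_neg_distrib, hH, mul_sub]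
    rw [Finset.sum_comm (f := fun i k => g.form ⁅b i, x⁆ (b k) * g.form (g.nabla (b k) y) (b i))]
    simp only [mul_comm (g.form ⁅_, x⁆ _)]
    ring
  have h6 : g.form g.meanCurvature (g.nabla x y) =
      (1 / 2) * (g.form ⁅g.meanCurvature, x⁆ y + g.form ⁅g.meanCurvature, y⁆ x) := by
    rw [g.symm, form_nabla, g.symm ⁅x, y⁆, form_meanCurvature, trace_ad_lie,
      ← lie_skew g.meanCurvature y]
    simp only [map_neg, LinearMap.neg_apply]
    ring
  -- the structure constants of `ad x` and `ad y`, and the pairings of brackets with `x` and `y`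
  set P : ι → ι → ℝ := fun i j => g.form ⁅x, b i⁆ (b j) with hP
  set Q : ι → ι → ℝ := fun i j => g.form ⁅y, b i⁆ (b j) with hQ
  set U : ι → ι → ℝ := fun i j => g.form ⁅b i, b j⁆ x with hU
  set W : ι → ι → ℝ := fun i j => g.form ⁅b i, b j⁆ y with hW
  have hUs : ∀ i j, U j i = - U i j := fun i j => by
    simp only [hU]; rw [← lie_skew (b j)]; simp only [map_neg, LinearMap.neg_apply]
  have hWs : ∀ i j, W j i = - W i j := fun i j => by
    simp only [hW]; rw [← lie_skew (b j)]; simp only [map_neg, LinearMap.neg_apply]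
  have h7 : ∀ i k, g.form (g.nabla (b i) y) (b k) *
        (g.form (g.nabla x (b i)) (b k) - g.form ⁅b k, x⁆ (b i)) =
      -(1 / 4) * ((Q i k + Q k i + W i k) * (P i k + P k i - U i k)) := by
    intro i k
    rw [form_nabla, form_nabla, ← lie_skew (b i) y, ← lie_skew (b k) x, ← lie_skew (b k) (b i)]
    simp only [hP, hQ, hU, hW, map_neg, LinearMap.neg_apply]
    ring
  have sw : ∀ f : ι → ι → ℝ, ∑ i, ∑ k, f k i = ∑ i, ∑ k, f i k := fun f => Finset.sum_comm
  have h8 : ∑ i, ∑ k, (Q i k + Q k i + W i k) * (P i k + P k i - U i k) =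
      2 * ∑ i, ∑ k, P i k * Q i k + 2 * ∑ i, ∑ k, P i k * Q k i - ∑ i, ∑ k, U i k * W i k := by
    have e1 := sw fun i k => P i k * Q i k
    have e2 := sw fun i k => P i k * Q k i
    have e3 : ∑ i, ∑ k, W i k * (P i k + P k i) = 0 := by
      have h := sw fun i k => W i k * (P i k + P k i)
      have h' : ∑ i, ∑ k, W k i * (P k i + P i k) = - ∑ i, ∑ k, W i k * (P i k + P k i) := by
        simp only [← Finset.sum_neg_distrib]
        refine Finset.sum_congr rfl fun i _ => Finset.sum_congr rfl fun k _ => ?_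
        rw [hWs i k]; ring
      linarith
    have e4 : ∑ i, ∑ k, U i k * (Q i k + Q k i) = 0 := by
      have h := sw fun i k => U i k * (Q i k + Q k i)
      have h' : ∑ i, ∑ k, U k i * (Q k i + Q i k) = - ∑ i, ∑ k, U i k * (Q i k + Q k i) := by
        simp only [← Finset.sum_neg_distrib]
        refine Finset.sum_congr rfl fun i _ => Finset.sum_congr rfl fun k _ => ?_
        rw [hUs i k]; ring
      linarith
    calc _ = ∑ i, ∑ k, (P i k * Q i k + P k i * Q k i + P i k * Q k i + P k i * Q i k
              + W i k * (P i k + P k i) - U i k * (Q i k + Q k i) - U i k * W i k) := by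
            refine Finset.sum_congr rfl fun i _ => Finset.sum_congr rfl fun k _ => ?_
            ring
      _ = _ := by
            simp only [Finset.sum_add_distrib, Finset.sum_sub_distrib, e1, e2, e3, e4]
            ring
  rw [h5, h6]
  simp only [h7, ← Finset.mul_sum, h8]
  ring

end Orthonormal

theorem ricci_symm (g : LeftInvMetric s) (x y : s) : g.ricci x y = g.ricci y x := by
  obtain ⟨b, -, hb, -⟩ := exists_basis_simultaneous_diagonal g.form 0 g.symm g.pos (by simp)
  rw [ricci_eq_sum hb x y, ricci_eq_sum hb y x,
    Finset.sum_comm (f := fun i j => g.form ⁅x, b i⁆ (b j) * g.form ⁅y, b j⁆ (b i))]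
  simp only [mul_comm (g.form ⁅x, _⁆ _), mul_comm (g.form _ x)]
  ring

/-! ### Bases adapted to the nilradical -/

open Matrix LieAlgebra

section

variable {s : Type*} [LieRing s] [LieAlgebra ℝ s]
variable {ι κ : Type*} [Fintype ι] [Fintype κ] [DecidableEq ι] [DecidableEq κ]

/-- A basis of `s` that is orthonormal for `g` and consists of vectors `b (inl i)` orthogonal to the
nilradical and vectors `b (inr k)` of the nilradical. -/
structure IsAdapted (g : LeftInvMetric s) (b : Module.Basis (ι ⊕ κ) ℝ s) : Prop where
  orthonormal : ∀ i j, g.form (b i) (b j) = if i = j then 1 else 0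
  inr_mem : ∀ k, b (.inr k) ∈ lieNilradical s
  inl_perp : ∀ i, ∀ x ∈ lieNilradical s, g.form (b (.inl i)) x = 0

/-- The matrix of the compression of `T` to the span of the vectors `b (inr k)`, for `b`
orthonormal. For an adapted `b` and `T = ad x` this is the matrix of `ad x` on the nilradical. -/
noncomputable def block (g : LeftInvMetric s) (b : Module.Basis (ι ⊕ κ) ℝ s) (T : s →ₗ[ℝ] s) :
    Matrix κ κ ℝ :=
  Matrix.of fun k l => g.form (T (b (.inr l))) (b (.inr k))

/-- The sum `∑ [Aᵢ, Aᵢᵀ]`, where `Aᵢ` is the matrix of `ad (b (inl i))` on the nilradical. -/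
noncomputable def commutatorSum (g : LeftInvMetric s) (b : Module.Basis (ι ⊕ κ) ℝ s) :
    Matrix κ κ ℝ :=
  ∑ i, (g.block b (ad ℝ s (b (.inl i))) * (g.block b (ad ℝ s (b (.inl i))))ᵀ
    - (g.block b (ad ℝ s (b (.inl i))))ᵀ * g.block b (ad ℝ s (b (.inl i))))

/-- The vectors `b (inl i)` act on the nilradical by operators commuting with each other's
adjoints. Besides the normality of each operator this asks for the mixed relations, so that
normality passes to linear combinations. -/
def NormalAction (g : LeftInvMetric s) (b : Module.Basis (ι ⊕ κ) ℝ s) : Prop :=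
  ∀ i j, g.block b (ad ℝ s (b (.inl i))) * (g.block b (ad ℝ s (b (.inl j))))ᵀ =
    (g.block b (ad ℝ s (b (.inl j))))ᵀ * g.block b (ad ℝ s (b (.inl i)))

variable {g : LeftInvMetric s} {b : Module.Basis (ι ⊕ κ) ℝ s}

omit [Fintype ι] [Fintype κ] [DecidableEq ι] [DecidableEq κ] in
theorem block_apply (T : s →ₗ[ℝ] s) (k l : κ) :
    g.block b T k l = g.form (T (b (.inr l))) (b (.inr k)) := rfl

omit [DecidableEq ι] [DecidableEq κ] in
theorem commutatorSum_transpose :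
    (g.commutatorSum b)ᵀ = g.commutatorSum b := by
  simp [commutatorSum, transpose_sum]

omit [DecidableEq ι] [DecidableEq κ] in
theorem trace_commutatorSum_mul {X : Matrix κ κ ℝ}
    (hX : ∀ i, g.block b (ad ℝ s (b (.inl i))) * X = X * g.block b (ad ℝ s (b (.inl i)))) :
    (g.commutatorSum b * X).trace = 0 := by
  rw [commutatorSum, Finset.sum_mul, trace_sum]
  exact Finset.sum_eq_zero fun i _ => trace_commutator_transpose_mul (hX i)

omit [DecidableEq ι] [DecidableEq κ] in
theorem NormalAction.commutatorSum_eq_zero (hA : g.NormalAction b) : g.commutatorSum b = 0 :=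
  Finset.sum_eq_zero fun i _ => sub_eq_zero.mpr (hA i i)

namespace IsAdapted

section

variable (hb : g.IsAdapted b)
include hb

omit [Fintype ι] [Fintype κ] in
theorem form_inl_of_mem {x : s} (hx : x ∈ lieNilradical s) (i : ι) :
    g.form x (b (.inl i)) = 0 := by rw [g.symm, hb.inl_perp i x hx]

theorem form_eq_sum_inr {x : s} (hx : x ∈ lieNilradical s) (y : s) :
    g.form x y = ∑ k, g.form x (b (.inr k)) * g.form y (b (.inr k)) := by
  rw [form_eq_sum hb.orthonormal, Fintype.sum_sum_type]
  simp [hb.form_inl_of_mem hx]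

theorem sum_form_inr_smul {x : s} (hx : x ∈ lieNilradical s) :
    ∑ k, g.form x (b (.inr k)) • b (.inr k) = x := by
  conv_rhs => rw [← sum_form_smul hb.orthonormal x, Fintype.sum_sum_type]
  simp [hb.form_inl_of_mem hx]

theorem sum_form_inl_smul {x : s} (hx : ∀ y ∈ lieNilradical s, g.form x y = 0) :
    ∑ i, g.form x (b (.inl i)) • b (.inl i) = x := by
  conv_rhs => rw [← sum_form_smul hb.orthonormal x, Fintype.sum_sum_type]
  simp [hx _ (hb.inr_mem _)]

theorem block_mul (S T : Module.End ℝ s) (hT : ∀ x ∈ lieNilradical s, T x ∈ lieNilradical s) :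
    g.block b (S * T) = g.block b S * g.block b T := by
  ext k l
  rw [mul_apply, block_apply, Module.End.mul_apply]
  conv_lhs => rw [← hb.sum_form_inr_smul (hT _ (hb.inr_mem l))]
  simp [block_apply, mul_comm]

end

variable [FiniteDimensional ℝ s] [IsSolvable s]

section

variable (hb : g.IsAdapted b) (hn : IsLieAbelian (lieNilradical s))
include hb hn

omit [FiniteDimensional ℝ s] [IsSolvable s] [Fintype ι] [Fintype κ] in
theorem block_ad_eq_zero {x : s} (hx : x ∈ lieNilradical s) : g.block b (ad ℝ s x) = 0 := by
  ext k l
  rw [block_apply, ad_apply, lie_eq_zero_of_mem_lieNilradical hn hx (hb.inr_mem l)]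
  simp

theorem block_ad_comm (x y : s) :
    g.block b (ad ℝ s x) * g.block b (ad ℝ s y) = g.block b (ad ℝ s y) * g.block b (ad ℝ s x) := by
  rw [← hb.block_mul _ _ fun z _ => lie_mem_lieNilradical y z,
    ← hb.block_mul _ _ fun z _ => lie_mem_lieNilradical x z]
  ext k l
  simp only [block_apply, Module.End.mul_apply, ad_apply]
  rw [leibniz_lie x y, lie_eq_zero_of_mem_lieNilradical hn (lie_mem_lieNilradical x y)
    (hb.inr_mem l), zero_add]

theorem normalAction_of_commutatorSum_eq_zero (h : g.commutatorSum b = 0) : g.NormalAction b :=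
  mul_transpose_comm_of_sum_commutator_eq_zero (A := fun i => g.block b (ad ℝ s (b (.inl i))))
    (fun _ _ => hb.block_ad_comm hn _ _) h

omit hn in
theorem form_meanCurvature_eq_trace (x : s) :
    g.form g.meanCurvature x = (g.block b (ad ℝ s x)).trace := by
  rw [form_meanCurvature, trace_eq_sum_form hb.orthonormal, Fintype.sum_sum_type]
  simp [Matrix.trace, block_apply, hb.form_inl_of_mem (lie_mem_lieNilradical _ _)]

theorem form_meanCurvature_of_mem {x : s} (hx : x ∈ lieNilradical s) :
    g.form g.meanCurvature x = 0 := by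
  rw [hb.form_meanCurvature_eq_trace, hb.block_ad_eq_zero hn hx, trace_zero]

omit hn in
theorem ricci_perp_perp {x y : s} (hx : ∀ z ∈ lieNilradical s, g.form x z = 0)
    (hy : ∀ z ∈ lieNilradical s, g.form y z = 0) :
    g.ricci x y = -(1 / 2) * ∑ i, ∑ k, g.form ⁅x, b (.inl i)⁆ (b (.inr k)) *
        g.form ⁅y, b (.inl i)⁆ (b (.inr k))
      - (1 / 2) * ((g.block b (ad ℝ s x) * (g.block b (ad ℝ s y))ᵀ).trace +
        (g.block b (ad ℝ s x) * g.block b (ad ℝ s y)).trace) := by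
  have hx' : ∀ u v : s, g.form ⁅u, v⁆ x = 0 := fun u v => by
    rw [g.symm, hx _ (lie_mem_lieNilradical u v)]
  have hy' : ∀ u v : s, g.form ⁅u, v⁆ y = 0 := fun u v => by
    rw [g.symm, hy _ (lie_mem_lieNilradical u v)]
  rw [ricci_eq_sum hb.orthonormal]
  simp only [Fintype.sum_sum_type, hx', hy', hb.form_inl_of_mem (lie_mem_lieNilradical _ _),
    Matrix.trace, diag_apply, mul_apply, transpose_apply, block_apply, ad_apply, mul_zero, zero_mul,
    Finset.sum_const_zero, add_zero, zero_add, sub_zero]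
  rw [Finset.sum_comm (f := fun i k => g.form ⁅x, b (.inr i)⁆ (b (.inr k)) *
    g.form ⁅y, b (.inr i)⁆ (b (.inr k))), Finset.sum_comm (f := fun i k =>
      g.form ⁅x, b (.inr i)⁆ (b (.inr k)) * g.form ⁅y, b (.inr k)⁆ (b (.inr i)))]
  ring

theorem ricci_perp_inr {x : s} (hx : ∀ z ∈ lieNilradical s, g.form x z = 0) (l : κ) :
    g.ricci x (b (.inr l)) = (1 / 2) * ∑ i, ∑ k, g.form ⁅x, b (.inl i)⁆ (b (.inr k)) *
        g.block b (ad ℝ s (b (.inl i))) k l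
      - (1 / 2) * g.form ⁅g.meanCurvature, x⁆ (b (.inr l)) := by
  have hx' : ∀ u v : s, g.form ⁅u, v⁆ x = 0 := fun u v => by
    rw [g.symm, hx _ (lie_mem_lieNilradical u v)]
  have h0 : ∀ k, ⁅b (.inr l), b (.inr k)⁆ = 0 := fun k =>
    lie_eq_zero_of_mem_lieNilradical hn (hb.inr_mem l) (hb.inr_mem k)
  have h1 : ∀ i k, g.form ⁅b (.inr l), b (.inl i)⁆ (b (.inr k)) =
      - g.block b (ad ℝ s (b (.inl i))) k l := fun i k => by
    rw [← lie_skew (b (.inr l))]; simp only [map_neg, LinearMap.neg_apply, block_apply, ad_apply]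
  rw [ricci_eq_sum hb.orthonormal]
  simp only [Fintype.sum_sum_type, hx', h0, h1, hb.form_inl_of_mem (lie_mem_lieNilradical _ _),
    mul_zero, zero_mul, map_zero, LinearMap.zero_apply,
    Finset.sum_const_zero, add_zero, zero_add, sub_zero, mul_neg, Finset.sum_neg_distrib]
  ring

theorem ricci_inr_inr (k l : κ) :
    g.ricci (b (.inr k)) (b (.inr l)) =
      ((1 / 2 : ℝ) • g.commutatorSum b) k l
      + (1 / 4) * ∑ i, ∑ j, g.form ⁅b (.inl i), b (.inl j)⁆ (b (.inr k)) *
          g.form ⁅b (.inl i), b (.inl j)⁆ (b (.inr l))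
      - (1 / 2) * (g.block b (ad ℝ s g.meanCurvature) k l
        + g.block b (ad ℝ s g.meanCurvature) l k) := by
  have h0 : ∀ k l, ⁅b (.inr l), b (.inr k)⁆ = 0 := fun k l =>
    lie_eq_zero_of_mem_lieNilradical hn (hb.inr_mem l) (hb.inr_mem k)
  have h1 : ∀ i k l, g.form ⁅b (.inr l), b (.inl i)⁆ (b (.inr k)) =
      - g.block b (ad ℝ s (b (.inl i))) k l := fun i k l => by
    rw [← lie_skew (b (.inr l))]; simp only [map_neg, LinearMap.neg_apply, block_apply, ad_apply]
  rw [ricci_eq_sum hb.orthonormal, commutatorSum]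
  simp only [Fintype.sum_sum_type, h0, h1, hb.form_inl_of_mem (lie_mem_lieNilradical _ _),
    mul_zero, zero_mul, map_zero, LinearMap.zero_apply, Finset.sum_const_zero, add_zero, zero_add,
    sub_zero, mul_neg, neg_mul, neg_neg, Finset.sum_add_distrib]
  rw [Finset.sum_comm (s := (Finset.univ : Finset κ))]
  simp only [Matrix.smul_apply, Matrix.sum_apply, Matrix.sub_apply, mul_apply, transpose_apply,
    Finset.sum_sub_distrib, block_apply, ad_apply, smul_eq_mul]
  ring

theorem ricciOp_eq_zero (h0 : ∀ i j, ⁅b (.inl i), b (.inl j)⁆ = 0)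
    (hA : ∀ i, (g.block b (ad ℝ s (b (.inl i))))ᵀ = - g.block b (ad ℝ s (b (.inl i)))) :
    g.ricciOp = 0 := by
  have htr : ∀ i, (g.block b (ad ℝ s (b (.inl i)))).trace = 0 := fun i => by
    have := congrArg Matrix.trace (hA i)
    rw [trace_transpose, trace_neg] at this
    linarith
  have hH : g.meanCurvature = 0 := by
    rw [← hb.sum_form_inl_smul fun x hx => hb.form_meanCurvature_of_mem hn hx]
    simp [hb.form_meanCurvature_eq_trace, htr]
  have key : ∀ p q, g.ricci (b p) (b q) = 0 := by
    have h1 : ∀ i l, g.ricci (b (.inl i)) (b (.inr l)) = 0 := fun i l => by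
      rw [hb.ricci_perp_inr hn (hb.inl_perp i)]; simp [h0, hH]
    rintro (i | k) (j | l)
    · rw [hb.ricci_perp_perp (hb.inl_perp i) (hb.inl_perp j), hA]; simp [h0]
    · exact h1 i l
    · rw [ricci_symm]; exact h1 j k
    · rw [hb.ricci_inr_inr hn]
      simp [commutatorSum, h0, hA, hH, block_apply]
  refine b.ext fun p => g.ext_left fun z => ?_
  rw [form_ricciOp]
  have : g.ricci (b p) = 0 := b.ext fun q => by simpa using key p q
  simp [this]

end

end IsAdapted

end

/-! ### Rigidity of solvsolitons -/

section

variable {s : Type*} [LieRing s] [LieAlgebra ℝ s] [FiniteDimensional ℝ s] [IsSolvable s]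

omit [FiniteDimensional ℝ s] [IsSolvable s] in
theorem IsAdapted.ofIsCompl {ι κ : Type*} [DecidableEq ι] [DecidableEq κ] {g : LeftInvMetric s}
    {a : Submodule ℝ s} (ha : IsCompl a (lieNilradical s).toSubmodule)
    (hperp : g.Perp a (lieNilradical s).toSubmodule) (u : Module.Basis ι ℝ a)
    (v : Module.Basis κ ℝ (lieNilradical s).toSubmodule)
    (hu : ∀ i j, g.form (u i) (u j) = if i = j then 1 else 0)
    (hv : ∀ k l, g.form (v k) (v l) = if k = l then 1 else 0) :
    g.IsAdapted ((u.prod v).map (Submodule.prodEquivOfIsCompl _ _ ha)) where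
  orthonormal := by
    rintro (i | k) (j | l)
    · simpa using hu i j
    · simpa using hperp _ (u i).2 _ (v l).2
    · rw [g.symm]; simpa using hperp _ (u j).2 _ (v k).2
    · simpa using hv k l
  inr_mem k := by simp
  inl_perp i x hx := by simpa using hperp _ (u i).2 x hx

omit [FiniteDimensional ℝ s] [IsSolvable s] in
theorem eq_of_forall_form_eq {g : LeftInvMetric s} {a n : Submodule ℝ s} (ha : IsCompl a n)
    {x y : s} (h1 : ∀ z ∈ a, g.form x z = g.form y z) (h2 : ∀ z ∈ n, g.form x z = g.form y z) :
    x = y := by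
  refine g.ext_left fun z => ?_
  obtain ⟨u, hu, v, hv, rfl⟩ := Submodule.mem_sup.mp (ha.sup_eq_top ▸ Submodule.mem_top : z ∈ a ⊔ n)
  rw [map_add, map_add, h1 u hu, h2 v hv]

/-- A symmetric derivation vanishes on the orthogonal complement `a` of the nilradical: it preserves
`a`, and an eigenvector in `a` with nonzero eigenvalue would lie in the nilradical. -/
theorem derivation_apply_eq_zero (hn : IsLieAbelian (lieNilradical s)) {g : LeftInvMetric s}
    {a : Submodule ℝ s} (ha : IsCompl a (lieNilradical s).toSubmodule)
    (hperp : g.Perp a (lieNilradical s).toSubmodule) (D : LieDerivation ℝ s s)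
    (hD : ∀ x y, g.form (D x) y = g.form x (D y)) {x : s} (hx : x ∈ a) : D x = 0 := by
  obtain ⟨u, d, hu, hd⟩ := exists_basis_simultaneous_diagonal (V := a)
    (g.form.restrict a) ((g.form.comp D.toLinearMap LinearMap.id).restrict a)
    (fun x y => g.symm x y) (fun x hx => g.pos x fun h => hx (Subtype.ext h))
    (fun x y => (hD x y).trans (g.symm _ _))
  have hd' : ∀ i j, g.form (D (u i)) (u j) = if i = j then d i else 0 := hd
  have hu' : ∀ i j, g.form (u i) (u j) = if i = j then 1 else 0 := hu
  have h1 : ∀ i, D (u i) = d i • (u i : s) := fun i => by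
    refine eq_of_forall_form_eq (g := g) ha (fun z hz => ?_) fun z hz => ?_
    · have h2 : (g.form (D (u i))).comp a.subtype = (g.form (d i • (u i : s))).comp a.subtype := by
        refine u.ext fun j => ?_
        simp [hd', hu']
      exact LinearMap.congr_fun h2 ⟨z, hz⟩
    · rw [hD, hperp _ (u i).2 _ (derivation_mem_lieNilradical hn D hz), map_smul,
        LinearMap.smul_apply, hperp _ (u i).2 _ hz, smul_zero]
  have h2 : ∀ i, d i = 0 := fun i => by
    by_contra hne
    have h3 := mem_lieNilradical_of_derivation_apply_eq_smul hn D hne (h1 i)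
    have h4 : (u i : s) = 0 := Submodule.disjoint_def.mp ha.disjoint _ (u i).2 h3
    exact u.ne_zero i (Subtype.ext h4)
  have h3 : D.toLinearMap ∘ₗ a.subtype = 0 := u.ext fun i => by
    simp [h1, h2]
  exact LinearMap.congr_fun h3 ⟨x, hx⟩

variable {ι κ : Type*} [Fintype ι] [Fintype κ] [DecidableEq ι] [DecidableEq κ]
  {g : LeftInvMetric s} {b : Module.Basis (ι ⊕ κ) ℝ s}

theorem IsAdapted.ricci_inl_self (hb : g.IsAdapted b) (i : ι) :
    g.ricci (b (.inl i)) (b (.inl i)) =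
      -(1 / 2) * ∑ j, ∑ k, g.form ⁅b (.inl i), b (.inl j)⁆ (b (.inr k)) ^ 2
      - (1 / 4) * ∑ k, ∑ l, (g.block b (ad ℝ s (b (.inl i))) k l +
        g.block b (ad ℝ s (b (.inl i))) l k) ^ 2 := by
  rw [hb.ricci_perp_perp (hb.inl_perp i) (hb.inl_perp i), trace_mul_transpose_add_trace_mul_self]
  simp only [← sq]
  ring

/-- The Ricci curvature of the complement of the nilradical is nonpositive; if it is a nonnegative
constant then the brackets of the complement vanish and it acts by skew operators, so that the
metric is Ricci flat. -/
theorem IsAdapted.const_neg (hb : g.IsAdapted b) (hn : IsLieAbelian (lieNilradical s))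
    (hflat : g.ricciOp ≠ 0) {c : ℝ} (hc : ∀ i, g.ricci (b (.inl i)) (b (.inl i)) = c) : c < 0 := by
  by_contra! hc0
  have key : ∀ i, (∀ j k, g.form ⁅b (.inl i), b (.inl j)⁆ (b (.inr k)) = 0) ∧
      ∀ k l, g.block b (ad ℝ s (b (.inl i))) k l + g.block b (ad ℝ s (b (.inl i))) l k = 0 := by
    intro i
    have h1 := hc i
    rw [hb.ricci_inl_self] at h1
    have h2 : 0 ≤ ∑ j, ∑ k, g.form ⁅b (.inl i), b (.inl j)⁆ (b (.inr k)) ^ 2 := by positivity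
    have h3 : 0 ≤ ∑ k, ∑ l, (g.block b (ad ℝ s (b (.inl i))) k l +
        g.block b (ad ℝ s (b (.inl i))) l k) ^ 2 := by positivity
    exact ⟨eq_zero_of_sum_sum_sq_nonpos (by linarith), eq_zero_of_sum_sum_sq_nonpos (by linarith)⟩
  refine hflat (hb.ricciOp_eq_zero hn (fun i j => ?_) fun i => ?_)
  · rw [← hb.sum_form_inr_smul (lie_mem_lieNilradical (b (.inl i)) (b (.inl j)))]
    simp [(key i).1]
  · ext k l
    exact eq_neg_of_add_eq_zero_left ((key i).2 l k)

/-- The structure of a solvsoliton with `c < 0` and abelian nilradical: the complement of the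
nilradical is an abelian subalgebra acting by normal operators. With `K = N / 2 + M / 4` the part of
the Ricci operator on the nilradical that does not involve `H`, pairing the soliton equation with
`K` gives `tr K² ≤ 0`. -/
theorem IsAdapted.rigidity (hb : g.IsAdapted b) (hn : IsLieAbelian (lieNilradical s))
    {c : ℝ} (hc : c < 0) (D : LieDerivation ℝ s s)
    (hRic : ∀ x y, g.ricci x y = c * g.form x y + g.form (D x) y)
    (hD : ∀ i, D (b (.inl i)) = 0) :
    (∀ i j, ⁅b (.inl i), b (.inl j)⁆ = 0) ∧
    g.NormalAction b := by
  set A : ι → Matrix κ κ ℝ := fun i => g.block b (ad ℝ s (b (.inl i))) with hA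
  set m : ι → ι → κ → ℝ := fun i j k => g.form ⁅b (.inl i), b (.inl j)⁆ (b (.inr k)) with hm
  set AH := g.block b (ad ℝ s g.meanCurvature) with hAH
  set E := g.block b D.toLinearMap with hE
  set N := g.commutatorSum b
  set M : Matrix κ κ ℝ := Matrix.of fun k l => ∑ i, ∑ j, m i j k * m i j l with hM
  set K : Matrix κ κ ℝ := (1 / 2 : ℝ) • N + (1 / 4 : ℝ) • M with hK
  have hKeq : K = c • (1 : Matrix κ κ ℝ) + Eᵀ + (1 / 2 : ℝ) • (AH + AHᵀ) := by
    ext k l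
    have h1 := hb.ricci_inr_inr hn k l
    rw [hRic, hb.orthonormal] at h1
    simp only [hK, hM, Matrix.add_apply, Matrix.smul_apply, Matrix.of_apply, transpose_apply,
      Matrix.one_apply, smul_eq_mul] at h1 ⊢
    rw [hE, block_apply]
    simp only [Sum.inr.injEq] at h1
    change c * _ + g.form (D.toLinearMap (b (.inr k))) (b (.inr l)) = _ at h1
    linarith
  have hNT : Nᵀ = N := commutatorSum_transpose
  have hMT : Mᵀ = M := by
    ext k l; simp only [hM, transpose_apply, of_apply, mul_comm]
  have hKT : Kᵀ = K := by simp [hK, hNT, hMT]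
  -- the symmetry of `D` is inherited from that of `Ric`
  have hET : Eᵀ = E := by
    have h1 : Eᵀ = K - c • (1 : Matrix κ κ ℝ) - (1 / 2 : ℝ) • (AH + AHᵀ) := by
      rw [hKeq]; abel
    have h2 : Eᵀᵀ = Eᵀ := by
      rw [h1]; simp [hKT, add_comm]
    rw [← h2, transpose_transpose]
  have hNtr : ∀ X : Matrix κ κ ℝ, (∀ i, A i * X = X * A i) → (N * X).trace = 0 := fun X hX =>
    trace_commutatorSum_mul hX
  have hMtr : ∀ T : Module.End ℝ s, (∀ x ∈ lieNilradical s, T x ∈ lieNilradical s) →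
      (M * g.block b T).trace = ∑ i, ∑ j, g.form (T ⁅b (.inl i), b (.inl j)⁆)
        ⁅b (.inl i), b (.inl j)⁆ := fun T hT => by
    have h1 : ∀ i j, g.form (T ⁅b (.inl i), b (.inl j)⁆) ⁅b (.inl i), b (.inl j)⁆ =
        ∑ k, ∑ l, m i j k * m i j l * g.block b T l k := by
      intro i j
      have hmem := lie_mem_lieNilradical (b (.inl i)) (b (.inl j))
      conv_lhs => rw [← hb.sum_form_inr_smul hmem]
      simp only [map_sum, map_smul, LinearMap.sum_apply, LinearMap.smul_apply, smul_eq_mul,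
        Finset.mul_sum]
      rw [Finset.sum_comm]
      refine Finset.sum_congr rfl fun k _ => Finset.sum_congr rfl fun l _ => ?_
      simp only [hm, block_apply]; ring
    simp only [h1, Matrix.trace, diag_apply, mul_apply, hM, of_apply, Finset.sum_mul]
    simp only [Finset.sum_comm (s := (Finset.univ : Finset κ)) (t := (Finset.univ : Finset ι))]
  -- `D` commutes with the action of the complement and kills the brackets of the complement
  have hEtr : (K * E).trace = 0 := by
    have h1 : ∀ i, A i * E = E * A i := fun i => by
      rw [hA, hE, ← hb.block_mul _ _ fun z hz => derivation_mem_lieNilradical hn D hz,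
        ← hb.block_mul _ _ fun z _ => lie_mem_lieNilradical (b (.inl i)) z]
      congr 1
      ext z
      change ⁅b (.inl i), D z⁆ = D ⁅b (.inl i), z⁆
      rw [LieDerivation.apply_lie_eq_add, hD, zero_lie, add_zero]
    have h2 : (M * E).trace = 0 := by
      rw [hE, hMtr _ fun z hz => derivation_mem_lieNilradical hn D hz]
      refine Finset.sum_eq_zero fun i _ => Finset.sum_eq_zero fun j _ => ?_
      change g.form (D _) _ = 0
      rw [LieDerivation.apply_lie_eq_add, hD, hD]
      simp
    rw [hK, add_mul, smul_mul_assoc, smul_mul_assoc, trace_add, trace_smul, trace_smul,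
      hNtr E h1, h2]
    simp
  -- the vanishing of the mixed component of `Ric`
  have hmixed : ∀ i l, ∑ j, ∑ k, m i j k * A j k l =
      g.form ⁅g.meanCurvature, b (.inl i)⁆ (b (.inr l)) := fun i l => by
    have h1 := hb.ricci_perp_inr hn (hb.inl_perp i) l
    rw [hRic, hb.orthonormal, hD] at h1
    simp only [reduceCtorEq, if_false, mul_zero, map_zero, LinearMap.zero_apply, add_zero] at h1
    simp only [hm, hA]
    linarith
  -- the Jacobi identity turns `⁅H, ⁅eᵢ, eⱼ⁆⁆` into brackets with `⁅H, eᵢ⁆`,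
  -- to which `hmixed` applies
  have hHtr : (M * AH).trace =
      -2 * ∑ i, ∑ l, g.form ⁅g.meanCurvature, b (.inl i)⁆ (b (.inr l)) ^ 2 := by
    rw [hAH, hMtr _ fun z _ => lie_mem_lieNilradical g.meanCurvature z]
    have h1 : ∀ i j, g.form (ad ℝ s g.meanCurvature ⁅b (.inl i), b (.inl j)⁆)
        ⁅b (.inl i), b (.inl j)⁆ =
        - g.form ⁅b (.inl j), ⁅g.meanCurvature, b (.inl i)⁆⁆ ⁅b (.inl i), b (.inl j)⁆
        - g.form ⁅b (.inl i), ⁅g.meanCurvature, b (.inl j)⁆⁆ ⁅b (.inl j), b (.inl i)⁆ := by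
      intro i j
      rw [ad_apply, leibniz_lie, ← lie_skew ⁅g.meanCurvature, b (.inl i)⁆ (b (.inl j)),
        ← lie_skew (b (.inl j)) (b (.inl i))]
      simp only [map_add, map_neg, LinearMap.add_apply, LinearMap.neg_apply]
      ring
    have h2 : ∀ i, ∑ j, g.form ⁅b (.inl j), ⁅g.meanCurvature, b (.inl i)⁆⁆
        ⁅b (.inl i), b (.inl j)⁆ =
        ∑ l, g.form ⁅g.meanCurvature, b (.inl i)⁆ (b (.inr l)) ^ 2 := by
      intro i
      have h3 : ∀ j, g.form ⁅b (.inl j), ⁅g.meanCurvature, b (.inl i)⁆⁆ ⁅b (.inl i), b (.inl j)⁆ =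
          ∑ l, g.form ⁅g.meanCurvature, b (.inl i)⁆ (b (.inr l)) * ∑ k, m i j k * A j k l := by
        intro j
        conv_lhs => rw [← hb.sum_form_inr_smul (lie_mem_lieNilradical g.meanCurvature (b (.inl i)))]
        simp only [lie_sum, lie_smul, map_sum, map_smul, LinearMap.sum_apply,
          LinearMap.smul_apply, smul_eq_mul]
        refine Finset.sum_congr rfl fun l _ => ?_
        rw [hb.form_eq_sum_inr (lie_mem_lieNilradical (b (.inl j)) (b (.inr l)))]
        congr 1
        refine Finset.sum_congr rfl fun k _ => ?_
        simp only [hm, hA, block_apply, ad_apply]; ring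
      simp only [h3]
      rw [Finset.sum_comm]
      simp only [← Finset.mul_sum, hmixed, sq]
    simp only [h1, Finset.sum_sub_distrib, Finset.sum_neg_distrib, h2]
    rw [Finset.sum_comm (f := fun i j => g.form ⁅b (.inl i), ⁅g.meanCurvature, b (.inl j)⁆⁆
      ⁅b (.inl j), b (.inl i)⁆)]
    simp only [h2]
    ring
  have hHtr' : (N * AH).trace = 0 := hNtr AH fun i => hb.block_ad_comm hn _ _
  have htrK : K.trace = (1 / 4) * ∑ k, ∑ i, ∑ j, m i j k ^ 2 := by
    have := hNtr 1 fun i => by rw [mul_one, one_mul]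
    rw [mul_one] at this
    rw [hK, trace_add, trace_smul, trace_smul, this]
    simp [Matrix.trace, hM, ← sq]
  have hsq : (K * Kᵀ).trace = c * K.trace + (K * AH).trace := by
    have h1 : (K * AHᵀ).trace = (K * AH).trace := by
      rw [← trace_transpose, transpose_mul, transpose_transpose, hKT, trace_mul_comm]
    rw [hKT]
    have h2 : K * K = K * (c • (1 : Matrix κ κ ℝ) + E + (1 / 2 : ℝ) • (AH + AHᵀ)) := by
      rw [hET] at hKeq; rw [← hKeq]
    rw [h2]
    simp only [mul_add, mul_smul_comm, mul_one, trace_add, trace_smul, hEtr, h1, smul_eq_mul]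
    ring
  have hKAH : (K * AH).trace = (1 / 4) * (M * AH).trace := by
    rw [hK, add_mul, smul_mul_assoc, smul_mul_assoc, trace_add, trace_smul, trace_smul, hHtr']
    simp
  rw [trace_mul_transpose_self, hKAH, hHtr, htrK] at hsq
  have p1 : 0 ≤ ∑ k, ∑ l, K k l ^ 2 := by positivity
  have p2 : 0 ≤ ∑ i, ∑ l, g.form ⁅g.meanCurvature, b (.inl i)⁆ (b (.inr l)) ^ 2 := by positivity
  have p3 : 0 ≤ ∑ k, ∑ i, ∑ j, m i j k ^ 2 := by positivity
  have p4 : c * ∑ k, ∑ i, ∑ j, m i j k ^ 2 ≤ 0 := mul_nonpos_of_nonpos_of_nonneg hc.le p3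
  have hm0 : ∀ i j k, m i j k = 0 := fun i j k => by
    have q0 : c * ∑ k, ∑ i, ∑ j, m i j k ^ 2 = 0 := by linarith
    have q1 := (mul_eq_zero.mp q0).resolve_left hc.ne
    have q2 := (Finset.sum_eq_zero_iff_of_nonneg fun _ _ => by positivity).mp q1 k
      (Finset.mem_univ k)
    exact eq_zero_of_sum_sum_sq_nonpos q2.le i j
  have hK0 : K = 0 := by
    ext k l
    exact eq_zero_of_sum_sum_sq_nonpos (by linarith) k l
  have hM0 : M = 0 := by ext k l; simp [hM, hm0]
  have hN0 : N = 0 := by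
    rw [hK, hM0, smul_zero, add_zero] at hK0
    exact (smul_eq_zero.mp hK0).resolve_left (by norm_num)
  refine ⟨fun i j => ?_, hb.normalAction_of_commutatorSum_eq_zero hn hN0⟩
  rw [← hb.sum_form_inr_smul (lie_mem_lieNilradical (b (.inl i)) (b (.inl j)))]
  exact Finset.sum_eq_zero fun k _ => by
    rw [show g.form ⁅b (.inl i), b (.inl j)⁆ (b (.inr k)) = 0 from hm0 i j k, zero_smul]

end

/-! ### Curvature when the complement of the nilradical is abelian -/

section

variable {s : Type*} [LieRing s] [LieAlgebra ℝ s] [FiniteDimensional ℝ s] [IsSolvable s]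
variable {ι κ : Type*} [Fintype ι] [Fintype κ] [DecidableEq ι] [DecidableEq κ]
  {g : LeftInvMetric s} {b : Module.Basis (ι ⊕ κ) ℝ s}

namespace IsAdapted

section AbelianComplement

variable (hb : g.IsAdapted b) (hn : IsLieAbelian (lieNilradical s))
  (h0 : ∀ i j, ⁅b (.inl i), b (.inl j)⁆ = 0)
include hb hn h0

omit [FiniteDimensional ℝ s] [IsSolvable s] hn in
theorem lie_eq_zero_of_perp {x y : s} (hx : ∀ z ∈ lieNilradical s, g.form x z = 0)
    (hy : ∀ z ∈ lieNilradical s, g.form y z = 0) : ⁅x, y⁆ = 0 := by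
  rw [← hb.sum_form_inl_smul hx, ← hb.sum_form_inl_smul hy]
  simp [sum_lie, lie_sum, h0]

omit hn in
theorem ricci_perp_perp_of_lie_eq_zero {x y : s} (hx : ∀ z ∈ lieNilradical s, g.form x z = 0)
    (hy : ∀ z ∈ lieNilradical s, g.form y z = 0) :
    g.ricci x y = - (1 / 2) * ((g.block b (ad ℝ s x) * (g.block b (ad ℝ s y))ᵀ).trace +
        (g.block b (ad ℝ s x) * g.block b (ad ℝ s y)).trace) := by
  rw [hb.ricci_perp_perp hx hy]
  simp only [hb.lie_eq_zero_of_perp h0 hx (hb.inl_perp _), map_zero, LinearMap.zero_apply,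
    zero_mul, Finset.sum_const_zero, mul_zero]
  ring

theorem ricci_perp_inr_of_lie_eq_zero {x : s} (hx : ∀ z ∈ lieNilradical s, g.form x z = 0)
    (l : κ) : g.ricci x (b (.inr l)) = 0 := by
  rw [hb.ricci_perp_inr hn hx, hb.lie_eq_zero_of_perp h0 (fun z hz =>
    hb.form_meanCurvature_of_mem hn hz) hx]
  simp [hb.lie_eq_zero_of_perp h0 hx (hb.inl_perp _)]

theorem ricci_inr_inr_of_lie_eq_zero (k l : κ) :
    g.ricci (b (.inr k)) (b (.inr l)) =
      ((1 / 2 : ℝ) • g.commutatorSum b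
      - (1 / 2 : ℝ) • (g.block b (ad ℝ s g.meanCurvature) +
        (g.block b (ad ℝ s g.meanCurvature))ᵀ)) k l := by
  rw [hb.ricci_inr_inr hn]
  simp [h0, mul_add]

theorem scal_eq : g.scal = ∑ i, g.ricci (b (.inl i)) (b (.inl i)) -
    g.form g.meanCurvature g.meanCurvature := by
  have h1 : ∑ k, g.ricci (b (.inr k)) (b (.inr k)) =
      - g.form g.meanCurvature g.meanCurvature := by
    rw [hb.form_meanCurvature_eq_trace]
    simp_rw [hb.ricci_inr_inr_of_lie_eq_zero hn h0]
    change Matrix.trace (_ - _) = _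
    have h2 := trace_commutatorSum_mul (g := g) (b := b) (X := 1) fun i => by
      rw [mul_one, one_mul]
    rw [mul_one] at h2
    rw [trace_sub, trace_smul, trace_smul, trace_add, trace_transpose, h2, smul_eq_mul,
      smul_eq_mul]
    ring
  rw [scal, trace_eq_sum_form hb.orthonormal, Fintype.sum_sum_type]
  simp only [form_ricciOp, h1]
  ring

/-- On the nilradical the Ricci operator is `N / 2` minus the symmetric part of `ad H`; the two
terms are orthogonal because `ad H` commutes with the action of the complement. -/
theorem normSq_ricciOp_eq : g.normSq g.ricciOp =
    ∑ i, ∑ j, g.ricci (b (.inl i)) (b (.inl j)) ^ 2 +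
    (1 / 4) * ∑ k, ∑ l,
      g.commutatorSum b k l ^ 2 -
    g.ricci g.meanCurvature g.meanCurvature := by
  set N := g.commutatorSum b with hN
  set B := g.block b (ad ℝ s g.meanCurvature) with hB
  have hNB : (N * B).trace = 0 := trace_commutatorSum_mul fun i => hb.block_ad_comm hn _ _
  have hNT : Nᵀ = N := commutatorSum_transpose
  have hNB' : (N * Bᵀ).trace = 0 := by
    rw [← trace_transpose, transpose_mul, transpose_transpose, hNT, trace_mul_comm, hNB]
  have h1 : ∑ k, ∑ l, g.ricci (b (.inr k)) (b (.inr l)) ^ 2 = (1 / 4) * ∑ k, ∑ l, N k l ^ 2 -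
      g.ricci g.meanCurvature g.meanCurvature := by
    simp_rw [hb.ricci_inr_inr_of_lie_eq_zero hn h0]
    rw [← trace_mul_transpose_self, ← trace_mul_transpose_self,
      hb.ricci_perp_perp_of_lie_eq_zero h0 (fun z hz => hb.form_meanCurvature_of_mem hn hz)
      (fun z hz => hb.form_meanCurvature_of_mem hn hz), ← hN, ← hB]
    have e1 : (Bᵀ * Bᵀ).trace = (B * B).trace := by rw [← transpose_mul, trace_transpose]
    have e2 : (Bᵀ * N).trace = 0 := by rw [trace_mul_comm, hNB']
    have e3 : (B * N).trace = 0 := by rw [trace_mul_comm, hNB]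
    have e4 : (Bᵀ * B).trace = (B * Bᵀ).trace := trace_mul_comm _ _
    simp only [transpose_sub, transpose_smul, transpose_add, transpose_transpose, hNT, sub_mul,
      mul_sub, smul_mul_assoc, mul_smul_comm, add_mul, mul_add, smul_add, trace_sub, trace_add,
      trace_smul, smul_eq_mul, hNB, hNB', e1, e2, e3, e4]
    ring
  have h2 : ∀ k i, g.ricci (b (.inr k)) (b (.inl i)) = 0 := fun k i => by
    rw [ricci_symm, hb.ricci_perp_inr_of_lie_eq_zero hn h0 (hb.inl_perp i)]
  rw [normSq_eq_sum hb.orthonormal, Fintype.sum_sum_type]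
  simp only [Fintype.sum_sum_type, form_ricciOp, h2,
    hb.ricci_perp_inr_of_lie_eq_zero hn h0 (hb.inl_perp _)]
  simp only [ne_eq, OfNat.ofNat_ne_zero, not_false_eq_true, zero_pow, Finset.sum_const_zero,
    add_zero, zero_add, h1]
  ring

end AbelianComplement

omit [FiniteDimensional ℝ s] [IsSolvable s] [Fintype κ] [DecidableEq ι] [DecidableEq κ] in
theorem block_sum_smul (x : s) (c : ι → ℝ) (hx : ∑ i, c i • b (.inl i) = x) :
    g.block b (ad ℝ s x) = ∑ i, c i • g.block b (ad ℝ s (b (.inl i))) := by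
  ext k l
  rw [← hx]
  simp [block_apply, Matrix.sum_apply]

omit [FiniteDimensional ℝ s] [IsSolvable s] in
theorem block_isNormal (hb : g.IsAdapted b)
    (hA : g.NormalAction b)
    {x : s} (hx : ∀ z ∈ lieNilradical s, g.form x z = 0) :
    g.block b (ad ℝ s x) * (g.block b (ad ℝ s x))ᵀ =
      (g.block b (ad ℝ s x))ᵀ * g.block b (ad ℝ s x) := by
  rw [block_sum_smul x _ (hb.sum_form_inl_smul hx)]
  simp only [transpose_sum, transpose_smul, Finset.sum_mul, Finset.mul_sum, smul_mul_assoc,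
    mul_smul_comm, Finset.smul_sum]
  rw [Finset.sum_comm]
  exact Finset.sum_congr rfl fun i _ => Finset.sum_congr rfl fun j _ => by
    rw [hA i j, smul_comm]

/-! ### Comparison of two metrics with the same orthogonal splitting -/

omit [FiniteDimensional ℝ s] [IsSolvable s] in
theorem basis_eq_smul {α : Type*} {b b' : Module.Basis α ℝ s} {w : α → ℝ} (hw : ∀ p, 0 < w p)
    (hbb' : ∀ p, b' p = (w p)⁻¹ • b p) (p : α) : b p = w p • b' p := by
  rw [hbb', smul_smul, mul_inv_cancel₀ (hw p).ne', one_smul]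

omit [FiniteDimensional ℝ s] [IsSolvable s] in
theorem lie_inl_inl_eq_zero {α β : Type*} {b b' : Module.Basis (α ⊕ β) ℝ s} {w : α ⊕ β → ℝ}
    (hbb' : ∀ p, b' p = (w p)⁻¹ • b p) (h0 : ∀ i j, ⁅b (.inl i), b (.inl j)⁆ = 0) (i j : α) :
    ⁅b' (.inl i), b' (.inl j)⁆ = 0 := by
  simp [hbb', h0]

section TwoMetrics

variable {g' : LeftInvMetric s} {b' : Module.Basis (ι ⊕ κ) ℝ s} {w : ι ⊕ κ → ℝ}
  (hb : g.IsAdapted b) (hb' : g'.IsAdapted b') (hw : ∀ p, 0 < w p)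
  (hbb' : ∀ p, b' p = (w p)⁻¹ • b p)
include hb hb' hw hbb'

omit [FiniteDimensional ℝ s] [IsSolvable s] [Fintype ι] [Fintype κ] hb in
theorem form_basis_basis (p q : ι ⊕ κ) : g'.form (b p) (b q) = if p = q then w q ^ 2 else 0 := by
  rw [basis_eq_smul hw hbb' p, basis_eq_smul hw hbb' q]
  simp only [map_smul, LinearMap.smul_apply, hb'.orthonormal, smul_eq_mul]
  split_ifs with h
  · subst h; ring
  · ring

omit [FiniteDimensional ℝ s] [IsSolvable s] in
theorem form_basis (x : s) (p : ι ⊕ κ) : g'.form x (b p) = w p ^ 2 * g.form x (b p) := by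
  conv_lhs => rw [← sum_form_smul hb.orthonormal x]
  simp only [map_sum, map_smul, LinearMap.sum_apply, LinearMap.smul_apply, smul_eq_mul,
    hb'.form_basis_basis hw hbb', mul_ite, mul_zero, Finset.sum_ite_eq', Finset.mem_univ,
    if_true]
  ring

omit [FiniteDimensional ℝ s] [IsSolvable s] in
theorem perp_of_perp {x : s} (hx : ∀ z ∈ lieNilradical s, g.form x z = 0) :
    ∀ z ∈ lieNilradical s, g'.form x z = 0 := by
  intro z hz
  rw [← hb.sum_form_inl_smul hx]
  simp [basis_eq_smul hw hbb' (.inl _), hb'.inl_perp _ z hz]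

omit [FiniteDimensional ℝ s] [IsSolvable s] in
theorem block_eq_conj (T : s →ₗ[ℝ] s) (k l : κ) :
    g'.block b' T k l = w (.inr k) * g.block b T k l * (w (.inr l))⁻¹ := by
  have := (hw (.inr k)).ne'
  simp only [block_apply, hbb', map_smul, LinearMap.smul_apply, smul_eq_mul,
    hb.form_basis hb' hw hbb']
  field_simp

omit [FiniteDimensional ℝ s] [IsSolvable s] in
theorem trace_block_mul (x y : s) :
    (g'.block b' (ad ℝ s x) * g'.block b' (ad ℝ s y)).trace =
      (g.block b (ad ℝ s x) * g.block b (ad ℝ s y)).trace := by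
  simp only [Matrix.trace, diag_apply, mul_apply, hb.block_eq_conj hb' hw hbb']
  refine Finset.sum_congr rfl fun k _ => Finset.sum_congr rfl fun l _ => ?_
  have h1 := (hw (.inr k)).ne'
  have h2 := (hw (.inr l)).ne'
  field_simp

/-- Among the metrics with the same orthogonal splitting, one for which the complement acts by
normal operators has the largest Ricci curvature on the complement. -/
theorem ricci_le_ricci
    (h0 : ∀ i j, ⁅b (.inl i), b (.inl j)⁆ = 0)
    (hA : g.NormalAction b)
    {x : s} (hx : ∀ z ∈ lieNilradical s, g.form x z = 0) : g'.ricci x x ≤ g.ricci x x := by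
  have hx' := hb.perp_of_perp hb' hw hbb' hx
  rw [hb.ricci_perp_perp_of_lie_eq_zero h0 hx hx, hb'.ricci_perp_perp_of_lie_eq_zero
    (lie_inl_inl_eq_zero hbb' h0) hx' hx', hb.trace_block_mul hb' hw hbb',
    trace_mul_transpose_self, trace_mul_transpose_self]
  have := sum_sq_le_sum_conj_sq (w := fun k => w (.inr k)) (hb.block_isNormal hA hx)
    (fun k => hw _)
  simp only [hb.block_eq_conj hb' hw hbb']
  linarith

omit [FiniteDimensional ℝ s] [IsSolvable s] in
/-- If the action is normal for both metrics, it commutes with the diagonal change of basis. -/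
theorem weight_mul_block
    (hA : g.NormalAction b)
    (hA' : g'.NormalAction b')
    {x : s} (hx : ∀ z ∈ lieNilradical s, g.form x z = 0) (k l : κ) :
    w (.inr k) * g.block b (ad ℝ s x) k l = g.block b (ad ℝ s x) k l * w (.inr l) := by
  have hx' := hb.perp_of_perp hb' hw hbb' hx
  refine mul_eq_mul_of_sum_conj_sq_le (w := fun k => w (.inr k)) (hb.block_isNormal hA hx)
    (fun k => hw _) ?_ k l
  have h1 := sum_sq_le_sum_conj_sq (w := fun k => (w (.inr k))⁻¹) (hb'.block_isNormal hA' hx')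
    (fun k => inv_pos.mpr (hw _))
  simp only [hb.block_eq_conj hb' hw hbb'] at h1
  refine h1.trans_eq (Finset.sum_congr rfl fun k _ => Finset.sum_congr rfl fun l _ => ?_)
  have h1 := (hw (.inr k)).ne'
  have h2 := (hw (.inr l)).ne'
  field_simp

end TwoMetrics

end IsAdapted

end

end LeftInvMetric

/-! ### The pinching estimate -/

theorem sum_sub_mean_sq {ι : Type*} [Fintype ι] [DecidableEq ι] [Nonempty ι] (S : ι → ι → ℝ) :
    ∑ i, ∑ j, (S i j - if i = j then (∑ i, S i i) / Fintype.card ι else 0) ^ 2 =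
      ∑ i, ∑ j, S i j ^ 2 - (∑ i, S i i) ^ 2 / Fintype.card ι := by
  have hr : (Fintype.card ι : ℝ) ≠ 0 := by exact_mod_cast Fintype.card_ne_zero
  set t := (∑ i, S i i) / Fintype.card ι with ht
  have h1 : ∀ i j, (S i j - if i = j then t else 0) ^ 2 =
      S i j ^ 2 + (if i = j then t ^ 2 - 2 * t * S i j else 0) := fun i j => by
    split_ifs <;> ring
  simp only [h1, Finset.sum_add_distrib, Finset.sum_ite_eq, Finset.mem_univ, if_true,
    Finset.sum_sub_distrib, ← Finset.mul_sum, Finset.sum_const, Finset.card_univ, nsmul_eq_mul]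
  have h2 : ∑ i, S i i = t * Fintype.card ι := by rw [ht]; field_simp
  rw [h2]
  field_simp
  ring

/-- The scalar inequality behind the pinching estimate. Here `r` is the dimension of the complement,
`-k` the soliton constant, `h`, `γ` and `h'` stand for `⟨H, H⟩`, `⟨H', H'⟩` and `⟨H', H'⟩'`, and
`P`, `S`, `ν` and `τ` for the traces and squared norms of the blocks of the Ricci operator of the
second metric. -/
theorem pinching_of_cauchy_schwarz {r k h P S ν τ γ h' : ℝ} (hr : 0 < r) (hk : 0 < k) (hh : 0 ≤ h)
    (hγ : 0 ≤ γ) (hτ : k * γ ≤ τ) (hcs : h' ^ 2 ≤ γ * h) :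
    k * (P - h') ^ 2 + (ν + (S - P ^ 2 / r)) * (r * k + h) ≤ (S + ν + τ) * (r * k + h) := by
  have h1 : 0 ≤ r * k + h := by positivity
  -- the cross term `-2 k P h'` is absorbed by the geometric mean of the two mixed products
  have h6 : 2 * k * (-P * h') ≤ P ^ 2 * h / r + k ^ 2 * γ * r := by
    refine le_trans (le_abs_self _) (abs_le_of_sq_le_sq ?_ (by positivity))
    have h3 : (2 * k * (-P * h')) ^ 2 ≤ 4 * (P ^ 2 * h / r) * (k ^ 2 * γ * r) := by
      have e1 : 4 * (P ^ 2 * h / r) * (k ^ 2 * γ * r) = 4 * k ^ 2 * P ^ 2 * (γ * h) := by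
        field_simp
      have e2 : (2 * k * (-P * h')) ^ 2 = 4 * k ^ 2 * P ^ 2 * h' ^ 2 := by ring
      rw [e1, e2]
      gcongr
    nlinarith [sq_nonneg (P ^ 2 * h / r - k ^ 2 * γ * r)]
  have h7 : (k * γ) * (r * k + h) ≤ τ * (r * k + h) := mul_le_mul_of_nonneg_right hτ h1
  have h8 : P ^ 2 / r * (r * k + h) = k * P ^ 2 + P ^ 2 * h / r := by field_simp
  have h9 : k * h' ^ 2 ≤ k * (γ * h) := mul_le_mul_of_nonneg_left hcs hk.le
  linarith

namespace LeftInvMetric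

open Matrix LieAlgebra

theorem form_self_nonneg {s : Type*} [LieRing s] [LieAlgebra ℝ s] (g : LeftInvMetric s) (x : s) :
    0 ≤ g.form x x := by
  by_cases h : x = 0
  · simp [h]
  · exact (g.pos x h).le

theorem form_sq_le {s : Type*} [LieRing s] [LieAlgebra ℝ s] (g : LeftInvMetric s) (x y : s) :
    g.form x y ^ 2 ≤ g.form x x * g.form y y :=
  g.form.apply_sq_le_of_symm g.form_self_nonneg ⟨g.symm⟩ x y

variable {s : Type*} [LieRing s] [LieAlgebra ℝ s] [FiniteDimensional ℝ s] [IsSolvable s]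

omit [IsSolvable s] in
/-- Two metrics with the same orthogonal splitting have adapted bases that differ by a positive
diagonal rescaling. -/
theorem exists_isAdapted_pair {g g' : LeftInvMetric s} {a : Submodule ℝ s}
    (ha : IsCompl a (lieNilradical s).toSubmodule) (hg : g.Perp a (lieNilradical s).toSubmodule)
    (hg' : g'.Perp a (lieNilradical s).toSubmodule) :
    ∃ (b b' : Module.Basis (Fin (Module.finrank ℝ a) ⊕
        Fin (Module.finrank ℝ (lieNilradical s).toSubmodule)) ℝ s)
      (w : Fin (Module.finrank ℝ a) ⊕ Fin (Module.finrank ℝ (lieNilradical s).toSubmodule) → ℝ),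
      g.IsAdapted b ∧ (∀ i, b (.inl i) ∈ a) ∧ g'.IsAdapted b' ∧ (∀ p, 0 < w p) ∧
      ∀ p, b' p = (w p)⁻¹ • b p := by
  obtain ⟨u, p, hu, hp⟩ := exists_basis_simultaneous_diagonal (V := a)
    (g.form.restrict a) (g'.form.restrict a)
    (fun x y => g.symm x y) (fun x hx => g.pos x fun h => hx (Subtype.ext h))
    (fun x y => g'.symm x y)
  obtain ⟨v, q, hv, hq⟩ := exists_basis_simultaneous_diagonal (V := (lieNilradical s).toSubmodule)
    (g.form.restrict _) (g'.form.restrict _)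
    (fun x y => g.symm x y) (fun x hx => g.pos x fun h => hx (Subtype.ext h))
    (fun x y => g'.symm x y)
  have hu : ∀ i j, g.form (u i) (u j) = if i = j then 1 else 0 := hu
  have hp : ∀ i j, g'.form (u i) (u j) = if i = j then p i else 0 := hp
  have hv : ∀ i j, g.form (v i) (v j) = if i = j then 1 else 0 := hv
  have hq : ∀ i j, g'.form (v i) (v j) = if i = j then q i else 0 := hq
  have hp0 : ∀ i, 0 < p i := fun i => by
    have := g'.pos (u i) fun h => u.ne_zero i (Subtype.ext h)
    rwa [hp, if_pos rfl] at this
  have hq0 : ∀ i, 0 < q i := fun i => by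
    have := g'.pos (v i) fun h => v.ne_zero i (Subtype.ext h)
    rwa [hq, if_pos rfl] at this
  have hb := IsAdapted.ofIsCompl ha hg u v hu hv
  set b := (u.prod v).map (Submodule.prodEquivOfIsCompl _ _ ha) with hbdef
  have hbl : ∀ i, b (.inl i) = u i := fun i => by simp [hbdef]
  have hbr : ∀ k, b (.inr k) = v k := fun k => by simp [hbdef]
  set w : Fin (Module.finrank ℝ a) ⊕ Fin (Module.finrank ℝ (lieNilradical s).toSubmodule) → ℝ :=
    Sum.elim (fun i => √(p i)) (fun k => √(q k)) with hwdef
  have hw : ∀ r, 0 < w r := by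
    rintro (i | k)
    · exact Real.sqrt_pos.mpr (hp0 i)
    · exact Real.sqrt_pos.mpr (hq0 k)
  have hgb : ∀ r t, g'.form (b r) (b t) = if r = t then w r * w r else 0 := by
    rintro (i | k) (j | l)
    · simp [hbl, hp, hwdef, Real.mul_self_sqrt (hp0 i).le]
    · simpa [hbl, hbr] using hg' _ (u i).2 _ (v l).2
    · rw [g'.symm]; simpa [hbl, hbr] using hg' _ (u j).2 _ (v k).2
    · simp [hbr, hq, hwdef, Real.mul_self_sqrt (hq0 k).le]
  set b' := b.isUnitSMul (w := fun r => (w r)⁻¹) fun r => (inv_ne_zero (hw r).ne').isUnit with hb'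
  have hbb' : ∀ r, b' r = (w r)⁻¹ • b r := fun r => Module.Basis.isUnitSMul_apply _ r
  refine ⟨b, b', w, hb, fun i => hbl i ▸ (u i).2, ⟨?_, ?_, ?_⟩, hw, hbb'⟩
  · intro r t
    have := (hw r).ne'
    simp only [hbb', map_smul, LinearMap.smul_apply, hgb, smul_eq_mul]
    split_ifs with h
    · subst h; field_simp
    · simp
  · intro k
    rw [hbb']
    exact (lieNilradical s).smul_mem _ (hb.inr_mem k)
  · intro i x hx
    rw [hbb', hbl, map_smul, LinearMap.smul_apply, hg' _ (u i).2 _ hx, smul_zero]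

omit [IsSolvable s] in
theorem normSq_zero (g : LeftInvMetric s) : g.normSq 0 = 0 := by
  simp [normSq]

namespace IsAdapted

variable {ι κ : Type*} [Fintype ι] [Fintype κ] [DecidableEq ι] [DecidableEq κ]
  {g g' : LeftInvMetric s} {b b' : Module.Basis (ι ⊕ κ) ℝ s} {w : ι ⊕ κ → ℝ}

section

variable (hb : g.IsAdapted b) (hn : IsLieAbelian (lieNilradical s))
  (h0 : ∀ i j, ⁅b (.inl i), b (.inl j)⁆ = 0)
  (hA : g.NormalAction b)
  {k : ℝ} (hk : 0 < k) (hRic : ∀ x y, (∀ z ∈ lieNilradical s, g.form x z = 0) →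
    (∀ z ∈ lieNilradical s, g.form y z = 0) → g.ricci x y = -k * g.form x y)
include hb hn h0 hA hk hRic

/-- The hypothesis `0 < k` excludes the junk value `0 / 0` of the quotient `F`. -/
theorem F_eq [Nonempty ι] :
    g.F = (Fintype.card ι * k + g.form g.meanCurvature g.meanCurvature) / k := by
  have hH : ∀ z ∈ lieNilradical s, g.form g.meanCurvature z = 0 := fun z hz =>
    hb.form_meanCurvature_of_mem hn hz
  have h1 : ∀ i j, g.ricci (b (.inl i)) (b (.inl j)) = if i = j then -k else 0 := fun i j => by
    rw [hRic _ _ (hb.inl_perp i) (hb.inl_perp j), hb.orthonormal]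
    simp
  have h2 := g.form_self_nonneg g.meanCurvature
  have hr : (0 : ℝ) < Fintype.card ι := by exact_mod_cast Fintype.card_pos
  rw [F, hb.scal_eq hn h0, hb.normSq_ricciOp_eq hn h0, hRic _ _ hH hH]
  simp only [h1, hA.commutatorSum_eq_zero, Matrix.zero_apply]
  simp only [if_true, Finset.sum_const, Finset.card_univ, nsmul_eq_mul, ite_pow,
    ne_eq, OfNat.ofNat_ne_zero, not_false_eq_true, zero_pow, Finset.sum_ite_eq, Finset.mem_univ,
    mul_zero, add_zero]
  rw [div_eq_div_iff (by nlinarith [mul_pos hk hk, mul_pos hr (mul_pos hk hk)]) hk.ne']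
  ring

variable (hb' : g'.IsAdapted b') (hw : ∀ p, 0 < w p) (hbb' : ∀ p, b' p = (w p)⁻¹ • b p)
include hb' hw hbb'

omit hn in
theorem sum_ricci_neg [Nonempty ι] : ∑ i, g'.ricci (b' (.inl i)) (b' (.inl i)) < 0 := by
  refine Finset.sum_neg (fun i _ => ?_) Finset.univ_nonempty
  have hx : ∀ z ∈ lieNilradical s, g.form (b' (.inl i)) z = 0 := fun z hz => by
    rw [hbb', map_smul, LinearMap.smul_apply, hb.inl_perp i z hz, smul_zero]
  have h1 := hb.ricci_le_ricci hb' hw hbb' h0 hA hx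
  rw [hRic _ _ hx hx] at h1
  have h2 := mul_pos hk (g.pos _ (b'.ne_zero (.inl i)))
  linarith

/-- The pinching estimate: `k * scal'² ≤ |Ric'|² * (r * k + |H|²)`, with a remainder that vanishes
only if `∑ [Aᵢ, Aᵢᵀ] = 0` for the second metric and its Ricci tensor is a multiple of the metric on
the complement of the nilradical. -/
theorem normSq_ricciOp_pinching [Nonempty ι] :
    k * g'.scal ^ 2 + ((1 / 4) * ∑ m, ∑ l,
      g'.commutatorSum b' m l ^ 2 +
      ∑ i, ∑ j, (g'.ricci (b' (.inl i)) (b' (.inl j)) -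
        if i = j then (∑ i, g'.ricci (b' (.inl i)) (b' (.inl i))) / Fintype.card ι else 0) ^ 2) *
      (Fintype.card ι * k + g.form g.meanCurvature g.meanCurvature) ≤
    g'.normSq g'.ricciOp * (Fintype.card ι * k + g.form g.meanCurvature g.meanCurvature) := by
  have hr : (0 : ℝ) < Fintype.card ι := by exact_mod_cast Fintype.card_pos
  have h0' := lie_inl_inl_eq_zero hbb' h0
  have hbb : ∀ p, b p = (w p)⁻¹⁻¹ • b' p := fun p => by
    rw [inv_inv, basis_eq_smul hw hbb']
  have hH' : ∀ z ∈ lieNilradical s, g'.form g'.meanCurvature z = 0 := fun z hz =>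
    hb'.form_meanCurvature_of_mem hn hz
  have hH : ∀ z ∈ lieNilradical s, g.form g'.meanCurvature z = 0 :=
    hb'.perp_of_perp hb (fun p => inv_pos.mpr (hw p)) hbb hH'
  have hτ := hb.ricci_le_ricci hb' hw hbb' h0 hA hH
  rw [hRic _ _ hH hH] at hτ
  have hcs := g.form_sq_le g'.meanCurvature g.meanCurvature
  rw [g.symm, form_meanCurvature, ← form_meanCurvature] at hcs
  rw [sum_sub_mean_sq, hb'.scal_eq hn h0', hb'.normSq_ricciOp_eq hn h0', sub_eq_add_neg _
    (g'.ricci g'.meanCurvature g'.meanCurvature)]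
  exact pinching_of_cauchy_schwarz hr hk (form_self_nonneg _ _) (form_self_nonneg _ _) (by linarith)
    hcs

omit hn in
theorem normSq_ricciOp_pos [Nonempty ι] : 0 < g'.normSq g'.ricciOp := by
  have h1 := hb.sum_ricci_neg h0 hA hk hRic hb' hw hbb'
  rw [normSq_eq_sum hb'.orthonormal]
  obtain ⟨i, -, hi⟩ : ∃ i ∈ Finset.univ, g'.ricci (b' (.inl i)) (b' (.inl i)) < 0 :=
    Finset.exists_lt_of_sum_lt (by simpa using h1)
  refine Finset.sum_pos' (fun p _ => by positivity) ⟨.inl i, Finset.mem_univ _, ?_⟩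
  refine Finset.sum_pos' (fun p _ => by positivity) ⟨.inl i, Finset.mem_univ _, ?_⟩
  rw [form_ricciOp]
  exact sq_pos_of_neg hi
end

end IsAdapted
/-! ### The equality case -/

theorem eq_of_form_basis_eq {s : Type*} [LieRing s] [LieAlgebra ℝ s] {g : LeftInvMetric s}
    {ι : Type*} (b : Module.Basis ι ℝ s) {x y : s} (h : ∀ i, g.form x (b i) = g.form y (b i)) :
    x = y :=
  g.ext_left fun z => LinearMap.congr_fun (b.ext h : g.form x = g.form y) z

variable {s : Type*} [LieRing s] [LieAlgebra ℝ s] [FiniteDimensional ℝ s] [IsSolvable s]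

namespace IsAdapted

variable {ι κ : Type*} [Fintype ι] [Fintype κ] [DecidableEq ι] [DecidableEq κ]
  {g g' : LeftInvMetric s} {b b' : Module.Basis (ι ⊕ κ) ℝ s} {w : ι ⊕ κ → ℝ}

/-- A diagonal operator that fixes the complement and commutes with its action on the nilradical is
an automorphism. -/
theorem exists_lieEquiv (hb : g.IsAdapted b) (hn : IsLieAbelian (lieNilradical s))
    (h0 : ∀ i j, ⁅b (.inl i), b (.inl j)⁆ = 0) {μ : ι ⊕ κ → ℝ} (hμ : ∀ p, μ p ≠ 0)
    (hμ1 : ∀ i, μ (.inl i) = 1)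
    (hcomm : ∀ i k l, μ (.inr k) * g.block b (ad ℝ s (b (.inl i))) k l =
      g.block b (ad ℝ s (b (.inl i))) k l * μ (.inr l)) :
    ∃ φ : s ≃ₗ⁅ℝ⁆ s, ∀ p, φ (b p) = μ p • b p := by
  let e : s ≃ₗ[ℝ] s := b.equiv (b.isUnitSMul fun p => (hμ p).isUnit) (Equiv.refl _)
  have he : ∀ p, e (b p) = μ p • b p := fun p => by
    simp [e, Module.Basis.isUnitSMul_apply]
  have h1 : ∀ i l, e ⁅b (.inl i), b (.inr l)⁆ = ⁅e (b (.inl i)), e (b (.inr l))⁆ := fun i l => by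
    rw [he, he, hμ1, one_smul, lie_smul,
      ← hb.sum_form_inr_smul (lie_mem_lieNilradical (b (.inl i)) (b (.inr l))), map_sum,
      Finset.smul_sum]
    refine Finset.sum_congr rfl fun k _ => ?_
    rw [map_smul, he, smul_smul, smul_smul]
    congr 1
    have := hcomm i k l
    rw [block_apply, ad_apply] at this
    linarith
  have h2 : ∀ p q, e ⁅b p, b q⁆ = ⁅e (b p), e (b q)⁆ := by
    rintro (i | k) (j | l)
    · rw [he, he, hμ1, hμ1, one_smul, one_smul, h0, map_zero]
    · exact h1 i l
    · rw [← lie_skew, map_neg, h1, lie_skew]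
    · rw [he, he, smul_lie, lie_smul,
        lie_eq_zero_of_mem_lieNilradical hn (hb.inr_mem k) (hb.inr_mem l)]
      simp
  have h3 : LinearMap.mk₂ ℝ (fun x y => e ⁅x, y⁆) (by simp) (by simp) (by simp) (by simp) =
      LinearMap.mk₂ ℝ (fun x y => ⁅e x, e y⁆) (by simp) (by simp) (by simp) (by simp) :=
    LinearMap.ext_basis b b h2
  exact ⟨{ e with map_lie' := fun {x y} => LinearMap.congr_fun₂ h3 x y }, he⟩

theorem meanCurvature_eq_smul (hb : g.IsAdapted b) (hn : IsLieAbelian (lieNilradical s))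
    (hb' : g'.IsAdapted b') (hw : ∀ p, 0 < w p) (hbb' : ∀ p, b' p = (w p)⁻¹ • b p)
    {t : ℝ} (ht : 0 < t) (hwt : ∀ i, w (.inl i) ^ 2 = t) :
    g'.meanCurvature = t⁻¹ • g.meanCurvature := by
  refine eq_of_form_basis_eq (g := g') b fun q => ?_
  rw [form_meanCurvature, ← form_meanCurvature g, map_smul, LinearMap.smul_apply,
    hb.form_basis hb' hw hbb', smul_eq_mul]
  rcases q with i | l
  · rw [hwt, inv_mul_cancel_left₀ ht.ne']
  · rw [hb.form_meanCurvature_of_mem hn (hb.inr_mem l)]; simp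

section

variable (hb : g.IsAdapted b) (hn : IsLieAbelian (lieNilradical s))
  (h0 : ∀ i j, ⁅b (.inl i), b (.inl j)⁆ = 0)
  (hA : g.NormalAction b)
  (hb' : g'.IsAdapted b') (hw : ∀ p, 0 < w p) (hbb' : ∀ p, b' p = (w p)⁻¹ • b p)
  (hN : g'.commutatorSum b' = 0)
include hb hn hA hb' hw hbb' hN

theorem weight_mul_block_of_sum_commutator_eq_zero {x : s}
    (hx : ∀ z ∈ lieNilradical s, g.form x z = 0) (m l : κ) :
    w (.inr m) * g.block b (ad ℝ s x) m l = g.block b (ad ℝ s x) m l * w (.inr l) :=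
  hb.weight_mul_block hb' hw hbb' hA (hb'.normalAction_of_commutatorSum_eq_zero hn hN) hx m l

theorem block_eq_block {x : s} (hx : ∀ z ∈ lieNilradical s, g.form x z = 0) :
    g'.block b' (ad ℝ s x) = g.block b (ad ℝ s x) := by
  ext m l
  rw [hb.block_eq_conj hb' hw hbb',
    hb.weight_mul_block_of_sum_commutator_eq_zero hn hA hb' hw hbb' hN hx, mul_assoc,
    mul_inv_cancel₀ (hw _).ne', mul_one]

include h0

theorem ricci_eq_ricci {x y : s} (hx : ∀ z ∈ lieNilradical s, g.form x z = 0)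
    (hy : ∀ z ∈ lieNilradical s, g.form y z = 0) : g'.ricci x y = g.ricci x y := by
  rw [hb.ricci_perp_perp_of_lie_eq_zero h0 hx hy, hb'.ricci_perp_perp_of_lie_eq_zero
    (lie_inl_inl_eq_zero hbb' h0) (hb.perp_of_perp hb' hw hbb' hx)
    (hb.perp_of_perp hb' hw hbb' hy), hb.block_eq_block hn hA hb' hw hbb' hN hx,
    hb.block_eq_block hn hA hb' hw hbb' hN hy]

/-- In the equality case both Ricci tensors are multiples of the metrics on the complement of the
nilradical, so the change of basis is a homothety there. -/
theorem weight_inl_sq {k : ℝ} (hk : 0 < k) (hRic : ∀ x y, (∀ z ∈ lieNilradical s, g.form x z = 0) →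
    (∀ z ∈ lieNilradical s, g.form y z = 0) → g.ricci x y = -k * g.form x y)
    {p : ℝ} (hp : ∀ i, g'.ricci (b' (.inl i)) (b' (.inl i)) = p) (i : ι) :
    w (.inl i) ^ 2 = -k / p ∧ p < 0 := by
  have h1 := hb.ricci_eq_ricci hn h0 hA hb' hw hbb' hN (hb.inl_perp i) (hb.inl_perp i)
  rw [hRic _ _ (hb.inl_perp i) (hb.inl_perp i), hb.orthonormal, if_pos rfl,
    basis_eq_smul hw hbb'] at h1
  simp only [map_smul, LinearMap.smul_apply, smul_eq_mul, hp] at h1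
  have h2 : 0 < w (.inl i) ^ 2 := pow_pos (hw _) 2
  have hp0 : p < 0 := by
    by_contra! h
    have : 0 ≤ w (.inl i) ^ 2 * p := mul_nonneg h2.le h
    linarith
  exact ⟨by rw [eq_div_iff hp0.ne]; linarith, hp0⟩

variable {t : ℝ} (ht : 0 < t) (hwt : ∀ i, w (.inl i) ^ 2 = t)
include ht hwt

theorem ricciOp_eq_smul : g'.ricciOp = t⁻¹ • g.ricciOp := by
  have h0' := lie_inl_inl_eq_zero hbb' h0
  have hH : ∀ z ∈ lieNilradical s, g.form g.meanCurvature z = 0 := fun z hz =>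
    hb.form_meanCurvature_of_mem hn hz
  have h1 : ∀ i l, g'.ricci (b (.inl i)) (b (.inr l)) = 0 := fun i l => by
    rw [basis_eq_smul hw hbb' (.inr l), map_smul, hb'.ricci_perp_inr_of_lie_eq_zero hn h0'
      (hb.perp_of_perp hb' hw hbb' (hb.inl_perp i)), smul_zero]
  have h2 : ∀ i l, g.ricci (b (.inl i)) (b (.inr l)) = 0 := fun i l =>
    hb.ricci_perp_inr_of_lie_eq_zero hn h0 (hb.inl_perp i) l
  refine b.ext fun p => eq_of_form_basis_eq (g := g') b fun q => ?_
  rw [form_ricciOp, LinearMap.smul_apply, map_smul, LinearMap.smul_apply,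
    hb.form_basis hb' hw hbb', form_ricciOp, smul_eq_mul]
  rcases p with i | m <;> rcases q with j | l
  · rw [hb.ricci_eq_ricci hn h0 hA hb' hw hbb' hN (hb.inl_perp i) (hb.inl_perp j), hwt,
      inv_mul_cancel_left₀ ht.ne']
  · rw [h1, h2]; simp
  · rw [ricci_symm, ricci_symm g, h1, h2]; simp
  · have e : g'.ricci (b (.inr m)) (b (.inr l)) =
        w (.inr m) * w (.inr l) * g'.ricci (b' (.inr m)) (b' (.inr l)) := by
      conv_lhs => rw [basis_eq_smul hw hbb' (.inr l), basis_eq_smul hw hbb' (.inr m)]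
      simp only [map_smul, LinearMap.smul_apply, smul_eq_mul]
      ring
    have c1 := hb.weight_mul_block_of_sum_commutator_eq_zero hn hA hb' hw hbb' hN hH m l
    have c2 := hb.weight_mul_block_of_sum_commutator_eq_zero hn hA hb' hw hbb' hN hH l m
    have hB : g'.block b' (ad ℝ s g'.meanCurvature) = t⁻¹ • g.block b (ad ℝ s g.meanCurvature) := by
      rw [hb.meanCurvature_eq_smul hn hb' hw hbb' ht hwt,
        ← hb.block_eq_block hn hA hb' hw hbb' hN hH]
      ext i j
      simp [block_apply]
    rw [e, hb'.ricci_inr_inr_of_lie_eq_zero hn h0', hb.ricci_inr_inr_of_lie_eq_zero hn h0, hN,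
      hA.commutatorSum_eq_zero, hB]
    simp only [smul_zero, zero_sub, Matrix.neg_apply, Matrix.smul_apply, Matrix.add_apply,
      transpose_apply, smul_eq_mul, transpose_smul]
    linear_combination (-(1 / 2) * t⁻¹ * w (.inr l)) * (c1 - c2)

end

end IsAdapted

/-- The comparison of a solvsoliton `g` with a single metric `g'` having the same orthogonal
splitting, with the rigidity statement in case of equality. -/
theorem IsSolvsoliton.F_le_and_equality (hn : IsLieAbelian (lieNilradical s)) {g : LeftInvMetric s}
    (hg : g.IsSolvsoliton) (hflat : g.ricciOp ≠ 0) {a : Submodule ℝ s}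
    (ha : IsCompl a (lieNilradical s).toSubmodule)
    (hperp : g.Perp a (lieNilradical s).toSubmodule) {g' : LeftInvMetric s}
    (hg' : g'.Perp a (lieNilradical s).toSubmodule) :
    g'.ricciOp ≠ 0 ∧ g'.F ≤ g.F ∧ (g.F ≤ g'.F → g'.IsSolvsoliton ∧
      ∃ c : ℝ, 0 < c ∧ ∃ φ : s ≃ₗ⁅ℝ⁆ s, ∀ x y : s, g'.form x y = c * g.form (φ x) (φ y)) := by
  obtain ⟨c, D, hD⟩ := hg
  have hRicD : ∀ x y, g.ricci x y = c * g.form x y + g.form (D x) y := fun x y => by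
    rw [← form_ricciOp, hD]
    simp
  have hDs : ∀ x y, g.form (D x) y = g.form x (D y) := fun x y => by
    have h1 := hRicD x y
    rw [ricci_symm, hRicD, g.symm y x, g.symm (D y)] at h1
    linarith
  have hDa : ∀ x ∈ a, D x = 0 := fun x hx => derivation_apply_eq_zero hn ha hperp D hDs hx
  obtain ⟨b, b', w, hb, hba, hb', hw, hbb'⟩ := exists_isAdapted_pair ha hperp hg'
  have hc : ∀ i, g.ricci (b (.inl i)) (b (.inl i)) = c := fun i => by
    rw [hRicD, hb.orthonormal, hDa _ (hba i)]
    simp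
  have hc0 : c < 0 := hb.const_neg hn hflat hc
  -- if `a = 0` then `c` may be replaced by any constant, contradicting its sign
  have hne : Nonempty (Fin (Module.finrank ℝ a)) := by
    by_contra hempty
    rw [not_nonempty_iff] at hempty
    have := hb.const_neg hn hflat (c := 1) (fun i => isEmptyElim i)
    linarith
  have hR : ∀ x y, (∀ z ∈ lieNilradical s, g.form x z = 0) →
      (∀ z ∈ lieNilradical s, g.form y z = 0) → g.ricci x y = - -c * g.form x y := by
    intro x y hx _
    have : D x = 0 := by
      rw [← hb.sum_form_inl_smul hx]
      simp [hDa _ (hba _)]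
    rw [hRicD, this, map_zero, LinearMap.zero_apply, add_zero, neg_neg]
  obtain ⟨h0, hA⟩ := hb.rigidity hn hc0 D hRicD fun i => hDa _ (hba i)
  have hk : 0 < -c := neg_pos.mpr hc0
  have hpos := hb.normSq_ricciOp_pos h0 hA hk hR hb' hw hbb'
  have hpin := hb.normSq_ricciOp_pinching hn h0 hA hk hR hb' hw hbb'
  have hF := hb.F_eq hn h0 hA hk hR
  have hX : 0 < (Fintype.card (Fin (Module.finrank ℝ a)) : ℝ) * -c +
      g.form g.meanCurvature g.meanCurvature := by
    have h1 : (0 : ℝ) < Fintype.card (Fin (Module.finrank ℝ a)) := by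
      exact_mod_cast Fintype.card_pos
    have := g.form_self_nonneg g.meanCurvature
    positivity
  set X := (Fintype.card (Fin (Module.finrank ℝ a)) : ℝ) * -c +
      g.form g.meanCurvature g.meanCurvature
  set N := g'.commutatorSum b' with hNdef
  set p := (∑ i, g'.ricci (b' (.inl i)) (b' (.inl i))) /
    Fintype.card (Fin (Module.finrank ℝ a)) with hp
  have hν : 0 ≤ ∑ m, ∑ l, N m l ^ 2 := by positivity
  have hσ : 0 ≤ ∑ i, ∑ j, (g'.ricci (b' (.inl i)) (b' (.inl j)) - if i = j then p else 0) ^ 2 := by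
    positivity
  refine ⟨fun h => ?_, ?_, fun hle => ?_⟩
  · rw [h, normSq_zero] at hpos
    exact lt_irrefl _ hpos
  · rw [hF, F, div_le_div_iff₀ hpos hk]
    have : 0 ≤ ((1 / 4) * ∑ m, ∑ l, N m l ^ 2 + ∑ i, ∑ j, (g'.ricci (b' (.inl i)) (b' (.inl j)) -
      if i = j then p else 0) ^ 2) * X := by positivity
    linarith
  · rw [hF, F, div_le_div_iff₀ hk hpos] at hle
    have h1 : ((1 / 4) * ∑ m, ∑ l, N m l ^ 2 + ∑ i, ∑ j, (g'.ricci (b' (.inl i)) (b' (.inl j)) -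
      if i = j then p else 0) ^ 2) * X ≤ 0 * X := by linarith
    have h2 := le_of_mul_le_mul_right h1 hX
    have hN : N = 0 := by
      ext m l
      exact eq_zero_of_sum_sum_sq_nonpos (by linarith) m l
    have hpp : ∀ i, g'.ricci (b' (.inl i)) (b' (.inl i)) = p := fun i => by
      have q := eq_zero_of_sum_sum_sq_nonpos (f := fun i j =>
        g'.ricci (b' (.inl i)) (b' (.inl j)) - if i = j then p else 0) (by linarith) i i
      rw [if_pos rfl] at q
      exact sub_eq_zero.mp q
    have hwi := hb.weight_inl_sq hn h0 hA hb' hw hbb' hN hk hR hpp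
    set t := - -c / p with htdef
    have ht : 0 < t := by
      have h3 := (hwi (Classical.arbitrary _)).2
      rw [htdef, neg_neg]
      exact div_pos_of_neg_of_neg hc0 h3
    have hop := hb.ricciOp_eq_smul hn h0 hA hb' hw hbb' hN ht fun i => (hwi i).1
    have hst : 0 < √t := Real.sqrt_pos.mpr ht
    refine ⟨⟨t⁻¹ * c, t⁻¹ • D, ?_⟩, t, ht, ?_⟩
    · rw [hop, hD, smul_add, smul_smul]
      rfl
    · obtain ⟨φ, hφ⟩ := hb.exists_lieEquiv hn h0 (μ := fun q => w q / √t)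
        (fun q => (div_pos (hw q) hst).ne') (fun i => by
          rw [← (hwi i).1, Real.sqrt_sq (hw _).le, div_self (hw _).ne']) fun i m l => by
          have := hb.weight_mul_block_of_sum_commutator_eq_zero hn hA hb' hw hbb' hN
            (hb.inl_perp i) m l
          rw [div_mul_eq_mul_div, this, mul_div_assoc]
      refine ⟨φ, fun x y => ?_⟩
      have h4 : g'.form = t • g.form.comp φ.toLinearEquiv.toLinearMap
          φ.toLinearEquiv.toLinearMap := by
        refine LinearMap.ext_basis b b fun q r => ?_
        rw [hb'.form_basis_basis hw hbb']
        change _ = t * g.form (φ (b q)) (φ (b r))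
        rw [hφ, hφ]
        simp only [map_smul, LinearMap.smul_apply, hb.orthonormal, smul_eq_mul]
        split_ifs with h
        · subst h
          have := Real.mul_self_sqrt ht.le
          field_simp
          rw [Real.sq_sqrt ht.le]
        · ring
      exact LinearMap.congr_fun₂ h4 x y

end LeftInvMetric

theorem theorem1p2 {s : Type*} [LieRing s] [LieAlgebra ℝ s] [FiniteDimensional ℝ s]
    [LieAlgebra.IsSolvable s] (hn : IsLieAbelian (lieNilradical s))
    (g : LeftInvMetric s) (hg : g.IsSolvsoliton) (hflat : g.ricciOp ≠ 0)
    (a : Submodule ℝ s) (ha : IsCompl a (lieNilradical s).toSubmodule)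
    (hperp : g.Perp a (lieNilradical s).toSubmodule) :
    (∀ g' : LeftInvMetric s, g'.Perp a (lieNilradical s).toSubmodule → g'.ricciOp ≠ 0) ∧
    IsMaxOn LeftInvMetric.F
      {g' : LeftInvMetric s | g'.Perp a (lieNilradical s).toSubmodule} g ∧
    ∀ g' : LeftInvMetric s, g'.Perp a (lieNilradical s).toSubmodule →
      IsMaxOn LeftInvMetric.F
        {g'' : LeftInvMetric s | g''.Perp a (lieNilradical s).toSubmodule} g' →
      g'.IsSolvsoliton ∧
        ∃ c : ℝ, 0 < c ∧ ∃ φ : s ≃ₗ⁅ℝ⁆ s,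
          ∀ x y : s, g'.form x y = c * g.form (φ x) (φ y) := by
  have main := fun g' hg' => hg.F_le_and_equality hn hflat ha hperp (g' := g') hg'
  exact ⟨fun g' hg' => (main g' hg').1, fun g' hg' => (main g' hg').2.1,
    fun g' hg' hmax => (main g' hg').2.2 (hmax hperp)⟩
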